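/- Let $a$ and $q$ be indeterminates. Write $(x;q)_k=\prod_{i=0}^{k-1}(1-xq^i)$ and $[n]=1+q+\cdots+q^{n-1}$. For rational functions $A,B\in\mathbb{Q}(a,q)$ and a polynomial $P\in\mathbb{Z}[a,q]$, write $A\equiv B\pmod P$ if $A-B=A_1/A_2$ for some $A_1,A_2\in\mathbb{Z}[a,q]$, $A_2\neq 0$, such that $P$ divides $A_1$ and $\gcd(P,A_2)=1$. For $k\ge 0$ put \[ c_q(k)=\frac{(aq;q^2)_k\,(q/a;q^2)_k\,(q;q^2)_{2k}}{(aq^6;q^6)_k\,(q^6/a;q^6)_k\,(q^2;q^2)_{2k}}\,[8k+1]\,q^{2k^2}, \qquad a_q(k)=\sum_{j=0}^{k}c_q(j)\,c_q(k-j). \] Then for every positive integer $n$ coprime to $6$, \[ \sum_{k=0}^{n-1}a_q(k)\equiv q^{-(n-1)}[n]^2\pmod{[n](1-aq^n)(a-q^n)}. \] -/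

import Mathlib

noncomputable section

/-- The `q`-shifted factorial `(a;q)_n = ∏_{i<n} (1 - a q^i)`. -/
def qPoch {R : Type*} [CommRing R] (a q : R) (n : ℕ) : R :=
  ∏ i ∈ Finset.range n, (1 - a * q ^ i)

/-- The `q`-integer `[n]_q = 1 + q + ⋯ + q^{n-1}`. -/
def qInt {R : Type*} [CommRing R] (q : R) (n : ℕ) : R :=
  ∑ i ∈ Finset.range n, q ^ i

/-- The `k`-th term `c_q(k)` of the series, for elements `a`, `q` of a field. -/
def cTerm {K : Type*} [Field K] (a q : K) (k : ℕ) : K :=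
  (qPoch (a * q) (q ^ 2) k * qPoch (q / a) (q ^ 2) k * qPoch q (q ^ 2) (2 * k)) /
    (qPoch (a * q ^ 6) (q ^ 6) k * qPoch (q ^ 6 / a) (q ^ 6) k * qPoch (q ^ 2) (q ^ 2) (2 * k)) *
    qInt q (8 * k + 1) * q ^ (2 * k ^ 2)

/-- The Cauchy-square coefficients `a_q(k) = ∑_{j=0}^{k} c_q(j) c_q(k-j)`. -/
def aCoeff {K : Type*} [Field K] (a q : K) (k : ℕ) : K :=
  ∑ j ∈ Finset.range (k + 1), cTerm a q j * cTerm a q (k - j)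

/-- The polynomial ring `ℤ[a, q]`, written as `ℤ[a][q]`. -/
abbrev PolyAQ : Type := Polynomial (Polynomial ℤ)

/-- The field `ℚ(a, q)` of rational functions in the two indeterminates `a` and `q`. -/
abbrev RatAQ : Type := FractionRing PolyAQ

/-- The indeterminate `a` of `ℤ[a, q]`. -/
def polyA : PolyAQ := Polynomial.C Polynomial.X

/-- The indeterminate `q` of `ℤ[a, q]`. -/
def polyQ : PolyAQ := Polynomial.X

/-- The indeterminate `a` as a rational function. -/
def ratA : RatAQ := algebraMap PolyAQ RatAQ polyA

/-- The indeterminate `q` as a rational function. -/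
def ratQ : RatAQ := algebraMap PolyAQ RatAQ polyQ

/-- Congruence `A ≡ B (mod P)` of rational functions: `A - B = A₁ / A₂` with polynomials
`A₁`, `A₂` such that `P` divides `A₁` and `gcd (P, A₂) = 1`. -/
def RatCongr (P : PolyAQ) (A B : RatAQ) : Prop :=
  ∃ A₁ A₂ : PolyAQ, A₂ ≠ 0 ∧
    A - B = algebraMap PolyAQ RatAQ A₁ / algebraMap PolyAQ RatAQ A₂ ∧
    P ∣ A₁ ∧ IsRelPrime P A₂

end

/-! Write `S(a)` for a partial sum of the `c_q(k)`. A `q`-WZ certificate (`wz_step`, `wz_sum`) gives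
`q³(1-a) S(aq⁶) = (1-aq⁶) S(a)` for every range of summation at whose ends the antidifference
vanishes. This relation is used in two ways.

At `a = qⁿ` the series stops before `k = (n+1)/2`. The relation moves `n` to `n+6`, so the cases `n
= 1` and `n = 5` give `S(qⁿ)² = q^{-(n-1)}[n]²` (`sum_cTerm_pow_sq`). Since the support lies in the
first half of the range, the truncated Cauchy square is the full square `S²`. The symmetry `a ↦ 1/a`
settles `a = q⁻ⁿ`.

At `q = ζ` of order `d = 2h+1` with `d ∣ n`, `d > 1`, and `a` generic, the terms fall into blocks of
length `d`. In each block the sums over `v ≤ h` and over `v > h` vanish separately: multiplied by `1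
+ a + ⋯ + a^{d-1}`, such a sum is a polynomial `W` of degree `< d` with `ζ³ W(ζ⁶a) = W(a)`, hence a
multiple of `a^h`, and it has a nonzero root (`sum_pochRatio_eq_zero`). Each half is moreover
supported on roughly its first half, so every partial sum met in the Cauchy square is either
complete or multiplied by a zero term (`sum_cauchy_eq_zero`). As `[n]` also vanishes at `ζ`, so does
the difference of the two sides.

Finally, the vanishing of the reduced numerator at these points becomes divisibility by `a - qⁿ`, `1
- aqⁿ` and the cyclotomic factors of `[n]`. -/

noncomputable section

/-! ### Shifted factorials and `q`-integers -/

section Pochhammer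

variable {R : Type*} [CommRing R]

theorem qPoch_zero (a q : R) : qPoch a q 0 = 1 := by simp [qPoch]

theorem qPoch_succ (a q : R) (n : ℕ) : qPoch a q (n + 1) = qPoch a q n * (1 - a * q ^ n) := by
  simp [qPoch, Finset.prod_range_succ]

theorem qPoch_add (a q : R) (m n : ℕ) :
    qPoch a q (m + n) = qPoch a q m * qPoch (a * q ^ m) q n := by
  simp only [qPoch, Finset.prod_range_add]
  congr 1
  refine Finset.prod_congr rfl fun i _ => ?_
  ring

theorem one_sub_mul_qInt (q : R) (n : ℕ) : (1 - q) * qInt q n = 1 - q ^ n :=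
  mul_neg_geom_sum q n

theorem qPoch_eq_zero {a q : R} {n i : ℕ} (hi : i < n) (h : a * q ^ i = 1) :
    qPoch a q n = 0 :=
  Finset.prod_eq_zero (Finset.mem_range.2 hi) (by rw [h, sub_self])

theorem qPoch_ne_zero [IsDomain R] {a q : R} {n : ℕ} (h : ∀ i < n, a * q ^ i ≠ 1) :
    qPoch a q n ≠ 0 :=
  Finset.prod_ne_zero_iff.2 fun i hi => sub_ne_zero.2 (h i (Finset.mem_range.1 hi)).symm

end Pochhammer

/-! ### The WZ relation between the parameters `a` and `aq⁶` -/

section Telescoping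

variable {F : Type*} [Field F]

/-- The part of `cTerm` that depends on `a`. -/
def pochRatio (a q : F) (k : ℕ) : F :=
  (qPoch (a * q) (q ^ 2) k * qPoch (q / a) (q ^ 2) k) /
    (qPoch (a * q ^ 6) (q ^ 6) k * qPoch (q ^ 6 / a) (q ^ 6) k)

/-- The quotient `(q;q²)_m / (q²;q²)_m`. -/
def oddEvenRatio (q : F) (m : ℕ) : F :=
  qPoch q (q ^ 2) m / qPoch (q ^ 2) (q ^ 2) m

theorem cTerm_eq (a q : F) (k : ℕ) :
    cTerm a q k =
      pochRatio a q k * oddEvenRatio q (2 * k) * qInt q (8 * k + 1) * q ^ (2 * k ^ 2) := by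
  rw [cTerm, pochRatio, oddEvenRatio, div_mul_div_comm]

theorem pochRatio_zero (a q : F) : pochRatio a q 0 = 1 := by simp [pochRatio, qPoch_zero]

theorem pochRatio_succ {a : F} (ha : a ≠ 0) (q : F) (k : ℕ) :
    pochRatio a q (k + 1) = pochRatio a q k *
      ((1 - a * q * q ^ (2 * k)) * (a - q * q ^ (2 * k)) /
        ((1 - a * q ^ 6 * q ^ (6 * k)) * (a - q ^ 6 * q ^ (6 * k)))) := by
  simp only [pochRatio, qPoch_succ, ← pow_mul]
  have h1 : 1 - q / a * q ^ (2 * k) = (a - q * q ^ (2 * k)) / a := by field_simp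
  have h2 : 1 - q ^ 6 / a * q ^ (6 * k) = (a - q ^ 6 * q ^ (6 * k)) / a := by field_simp
  rw [h1, h2, div_mul_div_comm]
  have : ∀ x y z w u v s t : F, x * y * (z * (w / a)) / (u * v * (s * (t / a))) =
      (x * z * (y * w)) / (u * s * (v * t)) := by
    intro x y z w u v s t
    rw [show x * y * (z * (w / a)) = (x * z * (y * w)) / a by ring,
      show u * v * (s * (t / a)) = (u * s * (v * t)) / a by ring, div_div_div_cancel_right₀ ha]
  rw [this]

theorem pochRatio_inv (a q : F) (k : ℕ) : pochRatio a⁻¹ q k = pochRatio a q k := by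
  simp only [pochRatio, div_eq_inv_mul q, div_eq_inv_mul (q ^ 6), inv_inv]
  rw [mul_comm (qPoch (a⁻¹ * q) _ _), mul_comm (qPoch (a⁻¹ * q ^ 6) _ _)]

/-- The hypergeometric term to which both `pochRatio a q` and `pochRatio (a * q ^ 6) q` are
rational multiples. -/
def wzBase (a q : F) (k : ℕ) : F :=
  (∏ i ∈ Finset.range k, (1 - a * q * q ^ (2 * i)) * (a * q ^ 5 - q ^ (2 * i)) /
    (q ^ 5 * (1 - a * q ^ 12 * q ^ (6 * i)) * (a - q ^ 6 * q ^ (6 * i)))) /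
    ((1 - a * q ^ 6) * (a - 1))

theorem wzBase_succ (a q : F) (k : ℕ) :
    wzBase a q (k + 1) = wzBase a q k *
      ((1 - a * q * q ^ (2 * k)) * (a * q ^ 5 - q ^ (2 * k)) /
        (q ^ 5 * (1 - a * q ^ 12 * q ^ (6 * k)) * (a - q ^ 6 * q ^ (6 * k)))) := by
  simp only [wzBase, Finset.prod_range_succ]
  ring

/-- Parameters for which the terms in the `WZ` relation have no poles. -/
structure Regular (a q : F) : Prop where
  a_ne : a ≠ 0
  q_ne : q ≠ 0
  up : ∀ k : ℕ, 1 - a * q ^ 6 * q ^ (6 * k) ≠ 0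
  down : ∀ k : ℕ, a - q ^ (6 * k) ≠ 0
  one : 1 - a * q ≠ 0
  three : 1 - a * q ^ 3 ≠ 0
  five : 1 - a * q ^ 5 ≠ 0

variable {a q : F}

theorem Regular.up' (h : Regular a q) (k : ℕ) : 1 - a * q ^ 12 * q ^ (6 * k) ≠ 0 := by
  have := h.up (k + 1)
  rwa [show a * q ^ 6 * q ^ (6 * (k + 1)) = a * q ^ 12 * q ^ (6 * k) by ring] at this

theorem Regular.down' (h : Regular a q) (k : ℕ) : a - q ^ 6 * q ^ (6 * k) ≠ 0 := by
  have := h.down (k + 1)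
  rwa [show q ^ (6 * (k + 1)) = q ^ 6 * q ^ (6 * k) by ring] at this

/-- Up to powers of `q`, the factors `aq⁵ - q^{2i}` of `wzBase` are the factors `a - q·q^{2i}` of
`pochRatio` shifted by three places, and `1 - aq^{12}q^{6i}` is `1 - aq⁶q^{6i}` shifted by one. The
quotient therefore telescopes to boundary factors. -/
theorem pochRatio_eq_wzBase (h : Regular a q) (k : ℕ) :
    pochRatio a q k * ((1 - a * q) * (1 - a * q ^ 3) * (1 - a * q ^ 5)) =
      wzBase a q k * ((a * q - q ^ (2 * k)) * (a * q ^ 3 - q ^ (2 * k)) *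
        (a * q ^ 5 - q ^ (2 * k)) * (1 - a) * (1 - a * q ^ 6 * q ^ (6 * k))) := by
  induction k with
  | zero =>
    have h1 := h.up 0
    have h2 := h.down 0
    simp only [mul_zero, pow_zero, mul_one] at h1 h2
    simp only [pochRatio_zero, wzBase, Finset.range_zero, Finset.prod_empty, mul_zero, pow_zero,
      mul_one]
    field_simp
    ring
  | succ k ih =>
    have h1 := h.up k
    have h2 := h.down' k
    have h3 := h.up' k
    have h4 := h.q_ne
    rw [pochRatio_succ h.a_ne, wzBase_succ, mul_right_comm, ih]
    have e1 : q ^ (2 * (k + 1)) = q ^ 2 * q ^ (2 * k) := by ring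
    have e2 : a * q ^ 6 * q ^ (6 * (k + 1)) = a * q ^ 12 * q ^ (6 * k) := by ring
    rw [e1, e2]
    generalize q ^ (2 * k) = z at *
    generalize q ^ (6 * k) = y at *
    field_simp

theorem pochRatio_shift_eq_wzBase (h : Regular a q) (k : ℕ) :
    pochRatio (a * q ^ 6) q k * ((1 - a * q) * (1 - a * q ^ 3) * (1 - a * q ^ 5)) =
      wzBase a q k * ((1 - a * q * q ^ (2 * k)) * (1 - a * q ^ 3 * q ^ (2 * k)) *
        (1 - a * q ^ 5 * q ^ (2 * k)) * (1 - a * q ^ 6) * (a - q ^ (6 * k))) := by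
  induction k with
  | zero =>
    have h1 := h.up 0
    have h2 := h.down 0
    simp only [mul_zero, pow_zero, mul_one] at h1 h2
    simp only [pochRatio_zero, wzBase, Finset.range_zero, Finset.prod_empty, mul_zero, pow_zero,
      mul_one]
    field_simp
  | succ k ih =>
    have h1 := h.down k
    have h2 := h.down' k
    have h3 := h.up' k
    have h4 := h.q_ne
    rw [pochRatio_succ (mul_ne_zero h.a_ne (pow_ne_zero 6 h4)), wzBase_succ, mul_right_comm, ih]
    have e1 : q ^ (2 * (k + 1)) = q ^ 2 * q ^ (2 * k) := by ring
    have e2 : q ^ (6 * (k + 1)) = q ^ 6 * q ^ (6 * k) := by ring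
    have e3 : 1 - a * q ^ 6 * q ^ 6 * q ^ (6 * k) = 1 - a * q ^ 12 * q ^ (6 * k) := by ring
    have e4 : a * q ^ 6 - q ^ 6 * q ^ (6 * k) = q ^ 6 * (a - q ^ (6 * k)) := by ring
    rw [e1, e2, e3, e4]
    generalize q ^ (2 * k) = z at *
    generalize q ^ (6 * k) = y at *
    field_simp

/-- The antidifference in the `WZ` relation. -/
def wzCert (a q : F) (h : ℕ → F) (k : ℕ) : F :=
  -((1 - a ^ 2 * q ^ 6) * (1 - a) * (1 - a * q ^ 6)) *
    (q * wzBase a q k * (1 - a * q ^ 6 * q ^ (6 * k)) * (a - q ^ (6 * k)) *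
      (1 - q ^ (4 * k)) * (q ^ 2 - q ^ (4 * k)) * h k * q ^ (2 * k ^ 2))

/-- After division by the common factor `wzBase`, this is a polynomial identity in `a`, `q` and `z =
q^{2k}`. The factor `h` enters only through a cross-multiplied recurrence, so it may be
`(q;q²)_{2k}/(q²;q²)_{2k}` or its index-shifted form at a root of unity, and factors of the
recurrence may vanish. -/
theorem wz_step (hr : Regular a q) (h : ℕ → F) (k : ℕ)
    (hrec : h (k + 1) * ((1 - q ^ (4 * k + 2)) * (1 - q ^ (4 * k + 4))) =
      h k * ((1 - q ^ (4 * k + 1)) * (1 - q ^ (4 * k + 3)))) :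
    (q ^ 3 * (1 - a) * pochRatio (a * q ^ 6) q k - (1 - a * q ^ 6) * pochRatio a q k) *
        (h k * (1 - q ^ (8 * k + 1)) * q ^ (2 * k ^ 2)) *
        ((1 - a * q) * (1 - a * q ^ 3) * (1 - a * q ^ 5)) =
      wzCert a q h (k + 1) - wzCert a q h k := by
  have h1 := pochRatio_eq_wzBase hr k
  have h2 := pochRatio_shift_eq_wzBase hr k
  have hq := hr.q_ne
  have e : wzBase a q (k + 1) * ((1 - a * q ^ 12 * q ^ (6 * k)) * (a - q ^ 6 * q ^ (6 * k)) *
      q ^ 5) = wzBase a q k * ((1 - a * q * q ^ (2 * k)) * (a * q ^ 5 - q ^ (2 * k))) := by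
    have := hr.up' k
    have := hr.down' k
    rw [wzBase_succ]
    field_simp
  have key : wzCert a q h (k + 1) = -((1 - a ^ 2 * q ^ 6) * (1 - a) * (1 - a * q ^ 6)) *
      (wzBase a q k * ((1 - a * q * q ^ (2 * k)) * (a * q ^ 5 - q ^ (2 * k))) *
        (h k * ((1 - q ^ (4 * k + 1)) * (1 - q ^ (4 * k + 3)))) *
        q ^ (4 * k) * q ^ (2 * k ^ 2)) := by
    rw [← e, ← hrec, wzCert]
    ring
  rw [key, wzCert]
  have e6 : q ^ (6 * k) = (q ^ (2 * k)) ^ 3 := by ring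
  have e4 : q ^ (4 * k) = (q ^ (2 * k)) ^ 2 := by ring
  have e8 : q ^ (8 * k + 1) = q * (q ^ (2 * k)) ^ 4 := by ring
  have e41 : q ^ (4 * k + 1) = q * (q ^ (2 * k)) ^ 2 := by ring
  have e43 : q ^ (4 * k + 3) = q ^ 3 * (q ^ (2 * k)) ^ 2 := by ring
  rw [e6] at h1 h2
  rw [e6, e4, e8, e41, e43]
  generalize q ^ (2 * k) = z at *
  generalize q ^ (2 * k ^ 2) = y at *
  generalize wzBase a q k = b at *
  linear_combination (q ^ 3 * (1 - a) * (h k * (1 - q * z ^ 4) * y)) * h2 -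
    ((1 - a * q ^ 6) * (h k * (1 - q * z ^ 4) * y)) * h1

/-- Telescoping of the `WZ` relation over an interval at whose ends the antidifference vanishes. -/
theorem wz_sum (hr : Regular a q) (h : ℕ → F) {m M : ℕ} (hmM : m ≤ M)
    (hrec : ∀ k, m ≤ k → k < M → h (k + 1) * ((1 - q ^ (4 * k + 2)) * (1 - q ^ (4 * k + 4))) =
      h k * ((1 - q ^ (4 * k + 1)) * (1 - q ^ (4 * k + 3))))
    (hm : wzCert a q h m = 0) (hM : wzCert a q h M = 0) :
    q ^ 3 * (1 - a) * ∑ k ∈ Finset.Ico m M, pochRatio (a * q ^ 6) q k *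
        (h k * (1 - q ^ (8 * k + 1)) * q ^ (2 * k ^ 2)) =
      (1 - a * q ^ 6) * ∑ k ∈ Finset.Ico m M, pochRatio a q k *
        (h k * (1 - q ^ (8 * k + 1)) * q ^ (2 * k ^ 2)) := by
  have hC : (1 - a * q) * (1 - a * q ^ 3) * (1 - a * q ^ 5) ≠ 0 :=
    mul_ne_zero (mul_ne_zero hr.one hr.three) hr.five
  have hs := Finset.sum_Ico_sub (wzCert a q h) hmM
  rw [hm, hM, sub_zero, Finset.sum_congr rfl fun k hk => (wz_step hr h k
    (hrec k (Finset.mem_Ico.1 hk).1 (Finset.mem_Ico.1 hk).2)).symm, ← Finset.sum_mul] at hs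
  have := (mul_eq_zero.1 hs).resolve_right hC
  rw [← sub_eq_zero, Finset.mul_sum, Finset.mul_sum, ← Finset.sum_sub_distrib, ← this]
  refine Finset.sum_congr rfl fun k _ => ?_
  ring

theorem wzCert_zero (a q : F) (h : ℕ → F) : wzCert a q h 0 = 0 := by simp [wzCert]

end Telescoping


/-! ### Evaluation of the terminating sums at `a = qⁿ` -/

section Terminating

variable {F : Type*} [Field F] {q : F}

theorem oddEvenRatio_succ {m : ℕ} (h : 1 - q ^ (2 * m + 2) ≠ 0) :
    oddEvenRatio q (m + 1) * (1 - q ^ (2 * m + 2)) = oddEvenRatio q m * (1 - q ^ (2 * m + 1)) := by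
  have e1 : 1 - q * (q ^ 2) ^ m = 1 - q ^ (2 * m + 1) := by ring
  have e2 : 1 - q ^ 2 * (q ^ 2) ^ m = 1 - q ^ (2 * m + 2) := by ring
  rw [oddEvenRatio, oddEvenRatio, qPoch_succ, qPoch_succ, e1, e2, mul_div_mul_comm, mul_assoc,
    div_mul_cancel₀ _ h]

theorem oddEvenRatio_add_two {m : ℕ} (h2 : 1 - q ^ (2 * m + 2) ≠ 0)
    (h4 : 1 - q ^ (2 * m + 4) ≠ 0) :
    oddEvenRatio q (m + 2) * ((1 - q ^ (2 * m + 2)) * (1 - q ^ (2 * m + 4))) =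
      oddEvenRatio q m * ((1 - q ^ (2 * m + 1)) * (1 - q ^ (2 * m + 3))) := by
  have e1 := oddEvenRatio_succ h2
  have e2 := oddEvenRatio_succ (q := q) (m := m + 1) h4
  rw [show 2 * (m + 1) + 2 = 2 * m + 4 by ring,
    show 2 * (m + 1) + 1 = 2 * m + 3 by ring] at e2
  linear_combination (1 - q ^ (2 * m + 2)) * e2 + (1 - q ^ (2 * m + 3)) * e1

theorem oddEvenRatio_double_succ {k : ℕ} (h2 : 1 - q ^ (4 * k + 2) ≠ 0)
    (h4 : 1 - q ^ (4 * k + 4) ≠ 0) :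
    oddEvenRatio q (2 * (k + 1)) * ((1 - q ^ (4 * k + 2)) * (1 - q ^ (4 * k + 4))) =
      oddEvenRatio q (2 * k) * ((1 - q ^ (4 * k + 1)) * (1 - q ^ (4 * k + 3))) := by
  rw [show 4 * k = 2 * (2 * k) by ring] at *
  exact oddEvenRatio_add_two h2 h4

theorem pochRatio_eq_zero (hq0 : q ≠ 0) {n k : ℕ} (hn : Odd n) (hk : n + 1 ≤ 2 * k) :
    pochRatio (q ^ n) q k = 0 := by
  obtain ⟨m, rfl⟩ := hn
  have : qPoch (q / q ^ (2 * m + 1)) (q ^ 2) k = 0 := by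
    refine qPoch_eq_zero (i := m) (by omega) ?_
    field_simp
    ring
  rw [pochRatio, this, mul_zero, zero_div]

theorem cTerm_eq_zero (hq0 : q ≠ 0) {n k : ℕ} (hn : Odd n) (hk : n + 1 ≤ 2 * k) :
    cTerm (q ^ n) q k = 0 := by
  rw [cTerm_eq, pochRatio_eq_zero hq0 hn hk]
  ring

theorem pow_ne_pow_of_no_root (hq0 : q ≠ 0) (hq : ∀ m : ℕ, 0 < m → q ^ m ≠ 1) {i j : ℕ}
    (hij : i ≠ j) : q ^ i ≠ q ^ j := by
  wlog h : i < j generalizing i j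
  · exact (this hij.symm (by omega)).symm
  intro e
  refine hq (j - i) (by omega) ?_
  have : q ^ i * q ^ (j - i) = q ^ i * 1 := by rw [← pow_add, mul_one, e]; congr 1; omega
  exact mul_left_cancel₀ (pow_ne_zero i hq0) this

theorem odd_of_coprime_six {n : ℕ} (hn : n.Coprime 6) : Odd n :=
  (Nat.coprime_two_right).1 (hn.coprime_dvd_right (by norm_num))

theorem not_three_dvd_of_coprime_six {n : ℕ} (hn : n.Coprime 6) : ¬ 3 ∣ n := fun h =>
  absurd (Nat.dvd_gcd h (by norm_num : 3 ∣ 6)) (by rw [hn]; norm_num)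

theorem regular_pow (hq0 : q ≠ 0) (hq : ∀ m : ℕ, 0 < m → q ^ m ≠ 1) {n : ℕ}
    (hn : n.Coprime 6) : Regular (q ^ n) q where
  a_ne := pow_ne_zero _ hq0
  q_ne := hq0
  up k := by
    rw [← pow_add, ← pow_add]
    exact sub_ne_zero.2 (hq _ (by omega)).symm
  down k := by
    refine sub_ne_zero.2 (pow_ne_pow_of_no_root hq0 hq ?_)
    have := odd_of_coprime_six hn
    rintro rfl
    rw [Nat.odd_iff] at this
    omega
  one := by
    rw [← pow_succ]
    exact sub_ne_zero.2 (hq _ (by omega)).symm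
  three := by
    rw [← pow_add]
    exact sub_ne_zero.2 (hq _ (by omega)).symm
  five := by
    rw [← pow_add]
    exact sub_ne_zero.2 (hq _ (by omega)).symm

theorem wzCert_pow_eq_zero (h : ℕ → F) {n k : ℕ} (hn : Odd n) (hk : n + 7 ≤ 2 * k) :
    wzCert (q ^ n) q h k = 0 := by
  obtain ⟨m, rfl⟩ := hn
  have : wzBase (q ^ (2 * m + 1)) q k = 0 := by
    -- The factor `aq⁵ - q^{2i}` with `a = q^{2m+1}` vanishes at `i = m + 3`.
    rw [wzBase, Finset.prod_eq_zero (i := m + 3) (Finset.mem_range.2 (by omega)), zero_div]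
    rw [show q ^ (2 * m + 1) * q ^ 5 - q ^ (2 * (m + 3)) = 0 by ring, mul_zero, zero_div]
  rw [wzCert, this]
  ring

theorem sum_cTerm_eq (a : F) (hq1 : 1 - q ≠ 0) (M : ℕ) :
    ∑ k ∈ Finset.range M, cTerm a q k = (∑ k ∈ Finset.Ico 0 M, pochRatio a q k *
      (oddEvenRatio q (2 * k) * (1 - q ^ (8 * k + 1)) * q ^ (2 * k ^ 2))) / (1 - q) := by
  rw [Finset.range_eq_Ico, Finset.sum_div]
  refine Finset.sum_congr rfl fun k _ => ?_
  rw [cTerm_eq, ← one_sub_mul_qInt]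
  field_simp

theorem sum_cTerm_pow_add_six (hq0 : q ≠ 0) (hq : ∀ m : ℕ, 0 < m → q ^ m ≠ 1) {n M : ℕ}
    (hn : n.Coprime 6) (hM : n + 7 ≤ 2 * M) :
    q ^ 3 * (1 - q ^ n) * ∑ k ∈ Finset.range M, cTerm (q ^ (n + 6)) q k =
      (1 - q ^ (n + 6)) * ∑ k ∈ Finset.range M, cTerm (q ^ n) q k := by
  have hq' : ∀ m : ℕ, 0 < m → 1 - q ^ m ≠ 0 := fun m hm => sub_ne_zero.2 (hq m hm).symm
  have hq1 : 1 - q ≠ 0 := by simpa using hq' 1 one_pos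
  have := wz_sum (regular_pow hq0 hq hn) (fun k => oddEvenRatio q (2 * k)) (Nat.zero_le M)
    (fun k _ _ => oddEvenRatio_double_succ (hq' _ (by omega)) (hq' _ (by omega)))
    (wzCert_zero _ _ _) (wzCert_pow_eq_zero _ (odd_of_coprime_six hn) hM)
  rw [← pow_add] at this
  rw [sum_cTerm_eq _ hq1, sum_cTerm_eq _ hq1, mul_div_assoc', mul_div_assoc', this]

theorem sum_cTerm_pow_eq_of_le (hq0 : q ≠ 0) {n m M : ℕ} (hn : Odd n) (hm : n + 1 ≤ 2 * m)
    (hM : m ≤ M) : ∑ k ∈ Finset.range M, cTerm (q ^ n) q k =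
      ∑ k ∈ Finset.range m, cTerm (q ^ n) q k := by
  refine (Finset.sum_subset (Finset.range_mono hM) fun k _ hk => ?_).symm
  rw [Finset.mem_range, not_lt] at hk
  exact cTerm_eq_zero hq0 hn (by omega)

theorem cTerm_zero (a q : F) : cTerm a q 0 = 1 := by simp [cTerm, qPoch_zero, qInt]

theorem sum_cTerm_pow_five (hq0 : q ≠ 0) (hq : ∀ m : ℕ, 0 < m → q ^ m ≠ 1) :
    (∑ k ∈ Finset.range 3, cTerm (q ^ 5) q k) * q ^ 2 * (1 - q) = -(1 - q ^ 5) := by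
  have hq' : ∀ m : ℕ, 0 < m → 1 - q ^ m ≠ 0 := fun m hm => sub_ne_zero.2 (hq m hm).symm
  have h1 : 1 - q ≠ 0 := by simpa using hq' 1 one_pos
  have h2 := hq' 2 (by omega)
  have h4 := hq' 4 (by omega)
  have h6 := hq' 6 (by omega)
  have h7 := hq' 7 (by omega)
  have h8 := hq' 8 (by omega)
  have h11 := hq' 11 (by omega)
  have h17 := hq' 17 (by omega)
  have e9 : qInt q 9 = (1 - q ^ 9) / (1 - q) := by rw [← one_sub_mul_qInt]; field_simp
  have e17 : qInt q 17 = (1 - q ^ 17) / (1 - q) := by rw [← one_sub_mul_qInt]; field_simp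
  have c1 : cTerm (q ^ 5) q 1 =
      -((1 - q ^ 6) * (1 - q ^ 3) * (1 - q ^ 9)) / (q ^ 2 * (1 - q ^ 11) * (1 - q ^ 2) * (1 - q)) := by
    simp only [cTerm, qPoch, Finset.prod_range_succ, Finset.prod_range_zero, one_mul, mul_one,
      ← pow_succ, ← pow_succ', ← pow_add, ← pow_mul]
    norm_num
    rw [e9, show q / q ^ 5 = 1 / q ^ 4 by field_simp, show q ^ 6 / q ^ 5 = q by field_simp]
    field_simp
    ring
  have c2 : cTerm (q ^ 5) q 2 =
      q ^ 2 * ((1 - q ^ 3) * (1 - q ^ 5)) / ((1 - q ^ 11) * (1 - q)) := by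
    simp only [cTerm, qPoch, Finset.prod_range_succ, Finset.prod_range_zero, one_mul, mul_one,
      ← pow_succ, ← pow_succ', ← pow_add, ← pow_mul]
    norm_num [Finset.prod_range_succ]
    rw [e17, show q / q ^ 5 = 1 / q ^ 4 by field_simp, show q ^ 6 / q ^ 5 = q by field_simp]
    rw [show 1 - q * q ^ 6 = 1 - q ^ 7 by ring,
      show 1 - 1 / q ^ 4 = -(1 - q ^ 4) / q ^ 4 by field_simp; ring,
      show 1 - 1 / q ^ 4 * q ^ 2 = -(1 - q ^ 2) / q ^ 2 by field_simp; ring]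
    field_simp
  rw [Finset.sum_range_succ, Finset.sum_range_succ, Finset.sum_range_one, cTerm_zero, c1, c2]
  field_simp
  ring

/-- Induction in steps of 6. Squaring removes the sign, which is negative at `n = 5`, and the
half-integral power of `q`. -/
theorem sum_cTerm_pow_sq (hq0 : q ≠ 0) (hq : ∀ m : ℕ, 0 < m → q ^ m ≠ 1) {n M : ℕ}
    (hn : n.Coprime 6) (hM : n + 1 ≤ 2 * M) :
    (∑ k ∈ Finset.range M, cTerm (q ^ n) q k) ^ 2 * q ^ n * (1 - q) ^ 2 = q * (1 - q ^ n) ^ 2 := by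
  induction n using Nat.strong_induction_on generalizing M with
  | _ n ih =>
    rcases lt_or_ge n 6 with h | h
    · have h15 : n = 1 ∨ n = 5 := by interval_cases n <;> revert hn <;> decide
      rcases h15 with rfl | rfl
      · rw [sum_cTerm_pow_eq_of_le hq0 odd_one le_rfl (by omega : 1 ≤ M), Finset.sum_range_one,
          cTerm_zero]
        ring
      · rw [sum_cTerm_pow_eq_of_le hq0 (by decide) (by norm_num : 5 + 1 ≤ 2 * 3)
          (by omega : 3 ≤ M)]
        have := sum_cTerm_pow_five hq0 hq
        linear_combination (q * ((∑ k ∈ Finset.range 3, cTerm (q ^ 5) q k) * q ^ 2 * (1 - q)) -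
          q * (1 - q ^ 5)) * this
    · obtain ⟨m, rfl⟩ := Nat.exists_eq_add_of_le' h
      have hm : m.Coprime 6 := by simpa using hn
      have hm0 : m ≠ 0 := by rintro rfl; revert hm; decide
      -- The same `M` serves both sums, because terms past the support are zero.
      have h1 := ih m (by omega) hm (M := M) (by omega)
      have h2 := sum_cTerm_pow_add_six hq0 hq hm hM
      have h3 : 1 - q ^ m ≠ 0 := sub_ne_zero.2 (hq m (by omega)).symm
      refine mul_left_cancel₀ (pow_ne_zero 2 h3) ?_
      generalize ∑ k ∈ Finset.range M, cTerm (q ^ (m + 6)) q k = S at *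
      generalize ∑ k ∈ Finset.range M, cTerm (q ^ m) q k = T at *
      linear_combination (q ^ m * (1 - q) ^ 2 * (q ^ 3 * (1 - q ^ m) * S +
        (1 - q ^ (m + 6)) * T)) * h2 + (1 - q ^ (m + 6)) ^ 2 * h1

/-- The sum of Cauchy coefficients of a sequence that vanishes in its second half. -/
theorem sum_cauchy_eq_sq {c : ℕ → F} {n m : ℕ} (hmn : m ≤ n) (hm : 2 * m ≤ n + 1)
    (hc : ∀ k, m ≤ k → c k = 0) :
    ∑ k ∈ Finset.range n, ∑ j ∈ Finset.range (k + 1), c j * c (k - j) =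
      (∑ k ∈ Finset.range m, c k) ^ 2 := by
  -- The triangle `i + j < n` contains the square `i, j < m`, since `2(m-1) < n`.
  rw [Finset.sum_range_diag_flip n fun i j => c i * c j, sq, Finset.sum_mul_sum]
  refine (Finset.sum_subset (Finset.range_mono hmn) fun k _ hk => ?_).symm.trans
    (Finset.sum_congr rfl fun k hk => ?_)
  · rw [Finset.mem_range, not_lt] at hk
    simp [hc k hk]
  · rw [Finset.mem_range] at hk
    refine (Finset.sum_subset (Finset.range_mono (by omega)) fun j _ hj => ?_).symm
    rw [Finset.mem_range, not_lt] at hj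
    simp [hc j hj]

theorem sum_aCoeff_pow (hq0 : q ≠ 0) (hq : ∀ m : ℕ, 0 < m → q ^ m ≠ 1) {n : ℕ}
    (hn : n.Coprime 6) :
    ∑ k ∈ Finset.range n, aCoeff (q ^ n) q k = q ^ (-((n : ℤ) - 1)) * qInt q n ^ 2 := by
  have hodd := odd_of_coprime_six hn
  have h1 : 1 - q ≠ 0 := sub_ne_zero.2 (by simpa using (hq 1 one_pos).symm)
  have key := sum_cTerm_pow_sq hq0 hq hn (M := (n + 1) / 2) (by rw [Nat.odd_iff] at hodd; omega)
  have hz : q ^ (-((n : ℤ) - 1)) = q / q ^ n := by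
    rw [neg_sub, zpow_sub₀ hq0, zpow_one, zpow_natCast]
  have hI : qInt q n = (1 - q ^ n) / (1 - q) := by rw [← one_sub_mul_qInt]; field_simp
  simp only [aCoeff]
  rw [Nat.odd_iff] at hodd
  rw [sum_cauchy_eq_sq (m := (n + 1) / 2) (by omega) (by omega) fun k hk =>
    cTerm_eq_zero hq0 (odd_of_coprime_six hn) (by omega), hz, hI]
  field_simp
  linear_combination key

theorem cTerm_inv (a q : F) (k : ℕ) : cTerm a⁻¹ q k = cTerm a q k := by
  rw [cTerm_eq, cTerm_eq, pochRatio_inv]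

end Terminating


/-! ### Vanishing of half-block sums at roots of unity -/

section RootOfUnity

open Polynomial

variable {F : Type*} [Field F]

/-- The polynomial `(1 - cX)(X - c)`, whose roots are `c` and `c⁻¹`. -/
def pairPoly (c : F) : F[X] := (1 - C c * X) * (X - C c)

theorem pairPoly_eq {c : F} (hc : c ≠ 0) :
    pairPoly c = C (-c) * ((X - C c⁻¹) * (X - C c)) := by
  have : (C c : F[X]) * C c⁻¹ = 1 := by rw [← C_mul, mul_inv_cancel₀ hc, C_1]
  rw [pairPoly, C_neg]
  linear_combination (-(X - C c)) * this

theorem natDegree_pairPoly {c : F} (hc : c ≠ 0) : (pairPoly c).natDegree = 2 := by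
  rw [pairPoly_eq hc, natDegree_C_mul (neg_ne_zero.2 hc),
    natDegree_mul (X_sub_C_ne_zero _) (X_sub_C_ne_zero _), natDegree_X_sub_C, natDegree_X_sub_C]

theorem pairPoly_ne_zero {c : F} (hc : c ≠ 0) : pairPoly c ≠ 0 := by
  intro h
  have := natDegree_pairPoly hc
  simp [h] at this

theorem eval_pairPoly (c a : F) : (pairPoly c).eval a = (1 - c * a) * (a - c) := by
  simp [pairPoly]

theorem natDegree_prod_pairPoly {s : Finset ℕ} {c : ℕ → F} (hc : ∀ i ∈ s, c i ≠ 0) :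
    (∏ i ∈ s, pairPoly (c i)).natDegree = 2 * s.card := by
  rw [natDegree_prod _ _ fun i hi => pairPoly_ne_zero (hc i hi),
    Finset.sum_congr rfl fun i hi => natDegree_pairPoly (hc i hi)]
  simp [mul_comm]

theorem isCoprime_X_sub_C {x y : F} (h : x ≠ y) : IsCoprime (X - C x : F[X]) (X - C y) :=
  isCoprime_X_sub_C_of_isUnit_sub (sub_ne_zero.2 h).isUnit

theorem isCoprime_pairPoly {c e : F} (hc : c ≠ 0) (he : e ≠ 0) (h1 : c ≠ e) (h2 : c * e ≠ 1) :
    IsCoprime (pairPoly c) (pairPoly e) := by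
  have u : ∀ {x : F}, x ≠ 0 → IsUnit (C (-x) : F[X]) := fun hx =>
    isUnit_C.2 (neg_ne_zero.2 hx).isUnit
  have h3 : c⁻¹ ≠ e := fun h => h2 (by rw [← h, mul_inv_cancel₀ hc])
  have h4 : c ≠ e⁻¹ := fun h => h2 (by rw [h, inv_mul_cancel₀ he])
  rw [pairPoly_eq hc, pairPoly_eq he, isCoprime_mul_unit_left_left (u hc),
    isCoprime_mul_unit_left_right (u he)]
  exact ((isCoprime_X_sub_C fun h => h1 (inv_injective h)).mul_right (isCoprime_X_sub_C h3)).mul_left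
    ((isCoprime_X_sub_C h4).mul_right (isCoprime_X_sub_C h1))

/-- The polynomial `1 + X + ⋯ + X^{d-1}`. -/
def geomPoly (F : Type*) [Field F] (d : ℕ) : F[X] := ∑ i ∈ Finset.range d, X ^ i

theorem geomPoly_mul (d : ℕ) : geomPoly F d * (X - 1) = X ^ d - 1 := geom_sum_mul X d

theorem eval_geomPoly_mul (d : ℕ) (a : F) : (geomPoly F d).eval a * (a - 1) = a ^ d - 1 := by
  simpa using congrArg (eval a) (geomPoly_mul (F := F) d)

theorem eval_geomPoly_eq_zero {d : ℕ} {a : F} (h : a ^ d = 1) (h1 : a ≠ 1) :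
    (geomPoly F d).eval a = 0 := by
  have := eval_geomPoly_mul d a
  rw [h, sub_self] at this
  exact (mul_eq_zero.1 this).resolve_right (sub_ne_zero.2 h1)

theorem geomPoly_ne_zero {d : ℕ} (hd : d ≠ 0) : geomPoly F d ≠ 0 := by
  intro h
  have := geomPoly_mul (F := F) d
  rw [h, zero_mul] at this
  exact X_pow_sub_C_ne_zero (Nat.pos_of_ne_zero hd) (1 : F) (by simpa using this.symm)

theorem natDegree_geomPoly (d : ℕ) (hd : d ≠ 0) : (geomPoly F d).natDegree = d - 1 := by
  have h := congrArg natDegree (geomPoly_mul (F := F) d)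
  rw [← C_1, natDegree_mul (geomPoly_ne_zero hd) (X_sub_C_ne_zero _), natDegree_X_sub_C,
    natDegree_X_pow_sub_C] at h
  omega

/-- The roots `c i` and `(c i)⁻¹` are pairwise distinct nontrivial `d`-th roots of unity; `h3` with
`i = j` separates `c i` from its own inverse. -/
theorem prod_pairPoly_dvd_geomPoly {d : ℕ} (hd : d ≠ 0) {s : Finset ℕ} {c : ℕ → F}
    (h1 : ∀ i ∈ s, c i ^ d = 1) (h2 : ∀ i ∈ s, c i ≠ 1)
    (h3 : ∀ i ∈ s, ∀ j ∈ s, c i * c j ≠ 1) (h4 : ∀ i ∈ s, ∀ j ∈ s, i ≠ j → c i ≠ c j) :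
    ∏ i ∈ s, pairPoly (c i) ∣ geomPoly F d := by
  have h0 : ∀ i ∈ s, c i ≠ 0 := by
    intro i hi h
    have := h1 i hi
    rw [h, zero_pow hd] at this
    exact zero_ne_one this
  refine Finset.prod_dvd_of_coprime (fun i hi j hj hij => ?_) fun i hi => ?_
  · exact isCoprime_pairPoly (h0 i hi) (h0 j hj) (h4 i hi j hj hij) (h3 i hi j hj)
  · rw [pairPoly_eq (h0 i hi),
      IsUnit.mul_left_dvd (isUnit_C.2 (neg_ne_zero.2 (h0 i hi)).isUnit)]
    refine IsCoprime.mul_dvd (isCoprime_X_sub_C fun h => h3 i hi i hi ?_) ?_ ?_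
    · nth_rw 1 [← h]
      exact inv_mul_cancel₀ (h0 i hi)
    · refine dvd_iff_isRoot.2 (eval_geomPoly_eq_zero ?_ ?_)
      · rw [inv_pow, h1 i hi, inv_one]
      · exact fun h => h2 i hi (inv_eq_one.1 h)
    · exact dvd_iff_isRoot.2 (eval_geomPoly_eq_zero (h1 i hi) (h2 i hi))

variable {ζ : F}

/-- Numerator of `pochRatio` as a polynomial in `a`. -/
def numPoly (ζ : F) (s : Finset ℕ) : F[X] := ∏ i ∈ s, pairPoly (ζ ^ (2 * i + 1))

/-- Denominator of `pochRatio` as a polynomial in `a`. -/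
def denPoly (ζ : F) (s : Finset ℕ) : F[X] := ∏ i ∈ s, pairPoly (ζ ^ (6 * i + 6))

theorem pochRatio_eq_eval {a : F} (ha : a ≠ 0) (v : ℕ) :
    pochRatio a ζ v = (numPoly ζ (Finset.range v)).eval a /
      (denPoly ζ (Finset.range v)).eval a := by
  induction v with
  | zero => simp [pochRatio_zero, numPoly, denPoly]
  | succ v ih =>
    rw [pochRatio_succ ha, ih]
    simp only [numPoly, denPoly, Finset.prod_range_succ, eval_mul, eval_pairPoly]
    rw [div_mul_div_comm]
    congr 3 <;> ring

theorem eval_denPoly_ne_zero {d : ℕ} (hζ : ζ ^ d = 1) {a : F} (had : a ^ d ≠ 1)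
    (s : Finset ℕ) : (denPoly ζ s).eval a ≠ 0 := by
  rw [denPoly, eval_prod]
  refine Finset.prod_ne_zero_iff.2 fun i _ => ?_
  have h : (ζ ^ (6 * i + 6)) ^ d = 1 := by rw [← pow_mul, mul_comm, pow_mul, hζ, one_pow]
  rw [eval_pairPoly]
  refine mul_ne_zero (sub_ne_zero.2 fun h' => had ?_) (sub_ne_zero.2 fun h' => had ?_)
  · have := congrArg (· ^ d) h'
    simpa [mul_pow, h] using this.symm
  · rw [h', h]

variable {d h : ℕ}

theorem root_pow_mul_eq_one_iff (hζ : IsPrimitiveRoot ζ d) {m j : ℕ} (hm : d.Coprime m) :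
    ζ ^ (m * j) = 1 ↔ d ∣ j := by
  rw [hζ.pow_eq_one_iff_dvd, hm.dvd_mul_left]

/-- Within either half, the residues `±(i+1)` modulo `d` are distinct and nonzero, and
multiplication by 6 preserves this. -/
theorem denPoly_dvd_geomPoly (hζ : IsPrimitiveRoot ζ d) (hd : d = 2 * h + 1) (h6 : d.Coprime 6)
    {s : Finset ℕ} (hs : s ⊆ Finset.range h ∨ s ⊆ Finset.Ico h (2 * h)) :
    denPoly ζ s ∣ geomPoly F d := by
  have hlt : ∀ i ∈ s, i + 1 < d := by
    intro i hi
    rcases hs with hs | hs <;> have := hs hi <;> simp at this <;> omega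
  refine prod_pairPoly_dvd_geomPoly (by omega) (fun i _ => ?_) (fun i hi => ?_)
    (fun i hi j hj => ?_) fun i hi j hj hij hc => hij ?_
  · rw [← pow_mul, mul_comm, pow_mul, hζ.pow_eq_one, one_pow]
  · rw [show 6 * i + 6 = 6 * (i + 1) by ring, Ne, root_pow_mul_eq_one_iff hζ h6]
    exact Nat.not_dvd_of_pos_of_lt (by omega) (hlt i hi)
  · rw [← pow_add, show 6 * i + 6 + (6 * j + 6) = 6 * (i + j + 2) by ring, Ne,
      root_pow_mul_eq_one_iff hζ h6]
    rcases hs with hs | hs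
    · have h1 := hs hi
      have h2 := hs hj
      rw [Finset.mem_range] at h1 h2
      exact Nat.not_dvd_of_pos_of_lt (by omega) (by omega)
    · have h1 := hs hi
      have h2 := hs hj
      rw [Finset.mem_Ico] at h1 h2
      exact Nat.not_dvd_of_lt_of_lt_mul_succ (n := d) (k := 1) (by omega) (by omega)
  · have h1 := (hζ.pow_of_coprime 6 h6.symm).pow_inj (hlt i hi) (hlt j hj)
      (by rw [← pow_mul, ← pow_mul, mul_add, mul_add]; exact hc)
    omega

theorem numPoly_dvd_geomPoly (hζ : IsPrimitiveRoot ζ d) (hd : d = 2 * h + 1) :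
    numPoly ζ (Finset.range h) ∣ geomPoly F d := by
  have h2 : d.Coprime 2 := Nat.coprime_two_right.2 ⟨h, hd⟩
  refine prod_pairPoly_dvd_geomPoly (by omega) (fun i _ => ?_) (fun i hi => ?_)
    (fun i hi j hj => ?_) fun i hi j hj hij hc => hij ?_
  · rw [← pow_mul, mul_comm, pow_mul, hζ.pow_eq_one, one_pow]
  · rw [Finset.mem_range] at hi
    rw [Ne, hζ.pow_eq_one_iff_dvd]
    exact Nat.not_dvd_of_pos_of_lt (by omega) (by omega)
  · rw [Finset.mem_range] at hi hj
    rw [← pow_add, show 2 * i + 1 + (2 * j + 1) = 2 * (i + j + 1) by ring, Ne,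
      root_pow_mul_eq_one_iff hζ h2]
    exact Nat.not_dvd_of_pos_of_lt (by omega) (by omega)
  · rw [Finset.mem_range] at hi hj
    have := hζ.pow_inj (by omega) (by omega) hc
    omega

/-- The reverse divisibility is known and both degrees equal `2h = d - 1`, so the cofactor is a
unit. -/
theorem geomPoly_dvd_numPoly (hζ : IsPrimitiveRoot ζ d) (hd : d = 2 * h + 1) :
    geomPoly F d ∣ numPoly ζ (Finset.range h) := by
  obtain ⟨g, hg⟩ := numPoly_dvd_geomPoly hζ hd
  have hζ0 : ζ ≠ 0 := hζ.ne_zero (by omega)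
  have hne : geomPoly F d ≠ 0 := geomPoly_ne_zero (by omega)
  have hn0 : numPoly ζ (Finset.range h) ≠ 0 := fun e => hne (by rw [hg, e, zero_mul])
  have hg0 : g ≠ 0 := fun e => hne (by rw [hg, e, mul_zero])
  have hdeg := congrArg natDegree hg
  rw [natDegree_mul hn0 hg0, natDegree_geomPoly d (by omega), numPoly,
    natDegree_prod_pairPoly fun i _ => pow_ne_zero _ hζ0, Finset.card_range] at hdeg
  have hu : IsUnit g := by
    rw [eq_C_of_natDegree_eq_zero (by omega : g.natDegree = 0)] at hg0 ⊢
    exact isUnit_C.2 (isUnit_iff_ne_zero.2 fun e => hg0 (by rw [e, C_0]))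
  rw [hg]
  exact (hu.mul_right_dvd).2 dvd_rfl

/-- `P` represents `a ↦ pochRatio a ζ v * (1 + a + ⋯ + a^{d-1})`. -/
structure Represents (ζ : F) (d v : ℕ) (P : F[X]) : Prop where
  natDegree_lt : P.natDegree < d
  eval_eq : ∀ a : F, a ≠ 0 → a ^ d ≠ 1 → P.eval a = pochRatio a ζ v * (geomPoly F d).eval a

theorem represents_of_mul_eq (hζ : ζ ^ d = 1) (hd : d ≠ 0) {v : ℕ} {P : F[X]}
    (hP : P * denPoly ζ (Finset.range v) = numPoly ζ (Finset.range v) * geomPoly F d) :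
    Represents ζ d v P := by
  have hζ0 : ζ ≠ 0 := by
    rintro rfl
    rw [zero_pow hd] at hζ
    exact zero_ne_one hζ
  have hn : (numPoly ζ (Finset.range v)).natDegree = 2 * v := by
    rw [numPoly, natDegree_prod_pairPoly fun i _ => pow_ne_zero _ hζ0, Finset.card_range]
  have hn' : (denPoly ζ (Finset.range v)).natDegree = 2 * v := by
    rw [denPoly, natDegree_prod_pairPoly fun i _ => pow_ne_zero _ hζ0, Finset.card_range]
  have hn0 : numPoly ζ (Finset.range v) ≠ 0 :=
    Finset.prod_ne_zero_iff.2 fun i _ => pairPoly_ne_zero (pow_ne_zero _ hζ0)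
  have hd0 : denPoly ζ (Finset.range v) ≠ 0 :=
    Finset.prod_ne_zero_iff.2 fun i _ => pairPoly_ne_zero (pow_ne_zero _ hζ0)
  have hP0 : P ≠ 0 := by
    rintro rfl
    rw [zero_mul] at hP
    exact mul_ne_zero hn0 (geomPoly_ne_zero hd) hP.symm
  refine ⟨?_, fun a ha had => ?_⟩
  · have := congrArg natDegree hP
    rw [natDegree_mul hP0 hd0, natDegree_mul hn0 (geomPoly_ne_zero hd), hn, hn',
      natDegree_geomPoly d hd] at this
    omega
  · have h1 := congrArg (eval a) hP
    rw [eval_mul, eval_mul] at h1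
    have h2 := eval_denPoly_ne_zero hζ had (Finset.range v)
    rw [pochRatio_eq_eval ha]
    field_simp
    exact h1

/-- The denominator divides `1 + a + ⋯ + a^{d-1}`. At `a = ζ³` the latter vanishes and the
denominator does not, so the cofactor supplies the root. -/
theorem exists_represents_lower (hζ : IsPrimitiveRoot ζ d) (hd : d = 2 * h + 1)
    (h6 : d.Coprime 6) {v : ℕ} (hv : v < h) :
    ∃ P, Represents ζ d v P ∧ P.eval (ζ ^ 3) = 0 := by
  obtain ⟨g, hg⟩ := denPoly_dvd_geomPoly (s := Finset.range v) hζ hd h6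
    (Or.inl (Finset.range_mono hv.le))
  refine ⟨numPoly ζ (Finset.range v) * g, represents_of_mul_eq hζ.pow_eq_one (by omega)
    (by rw [hg]; ring), ?_⟩
  have h3 : ¬ d ∣ 3 := fun hdvd => by
    have : d.Coprime 3 := h6.coprime_dvd_right (by norm_num)
    have := Nat.Coprime.eq_one_of_dvd this hdvd
    omega
  have he : (geomPoly F d).eval (ζ ^ 3) = 0 := by
    refine eval_geomPoly_eq_zero ?_ ?_
    · rw [← pow_mul, mul_comm, pow_mul, hζ.pow_eq_one, one_pow]
    · rwa [Ne, hζ.pow_eq_one_iff_dvd]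
  rw [hg, eval_mul] at he
  rw [eval_mul, (mul_eq_zero.1 he).resolve_left, mul_zero]
  rw [denPoly, eval_prod]
  refine Finset.prod_ne_zero_iff.2 fun i hi => ?_
  rw [Finset.mem_range] at hi
  have c3 : d.Coprime 3 := h6.coprime_dvd_right (by norm_num)
  rw [eval_pairPoly]
  refine mul_ne_zero (sub_ne_zero.2 fun e => ?_) (sub_ne_zero.2 fun e => ?_)
  · rw [← pow_add, show 6 * i + 6 + 3 = 3 * (2 * i + 3) by ring, eq_comm,
      root_pow_mul_eq_one_iff hζ c3] at e
    exact Nat.not_dvd_of_pos_of_lt (by omega) (by omega) e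
  · have : ζ ^ 3 * ζ ^ (3 * (2 * i + 1)) = ζ ^ 3 * 1 := by
      rw [mul_one, ← pow_add, e]
      congr 1
      ring
    have := mul_left_cancel₀ (pow_ne_zero 3 (hζ.ne_zero (by omega))) this
    rw [root_pow_mul_eq_one_iff hζ c3] at this
    exact Nat.not_dvd_of_pos_of_lt (by omega) (by omega) this

/-- The denominator factors with `i < h` are cleared by `1 + a + ⋯ + a^{d-1}`, those with `i ≥ h` by
the copy of it contained in the numerator. The numerator factor `i = h` survives; it is `(1-a)(a-1)`
because `ζ^{2h+1} = 1`. -/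
theorem exists_represents_upper (hζ : IsPrimitiveRoot ζ d) (hd : d = 2 * h + 1)
    (h6 : d.Coprime 6) {v : ℕ} (hv : h < v) (hvd : v < d) :
    ∃ P, Represents ζ d v P ∧ P.eval 1 = 0 := by
  obtain ⟨g₁, hg₁⟩ := denPoly_dvd_geomPoly (s := Finset.Ico h v) hζ hd h6
    (Or.inr (Finset.Ico_subset_Ico_right (by omega)))
  obtain ⟨g₂, hg₂⟩ := denPoly_dvd_geomPoly (s := Finset.range h) hζ hd h6 (Or.inl subset_rfl)
  obtain ⟨g₃, hg₃⟩ := geomPoly_dvd_numPoly hζ hd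
  have e1 : numPoly ζ (Finset.range v) = numPoly ζ (Finset.range h) *
      (pairPoly (ζ ^ (2 * h + 1)) * numPoly ζ (Finset.Ico (h + 1) v)) := by
    rw [numPoly, numPoly, numPoly, ← Finset.prod_range_mul_prod_Ico _ hv.le,
      Finset.prod_eq_prod_Ico_succ_bot hv]
  have e2 : denPoly ζ (Finset.range v) =
      denPoly ζ (Finset.range h) * denPoly ζ (Finset.Ico h v) :=
    (Finset.prod_range_mul_prod_Ico _ hv.le).symm
  refine ⟨pairPoly (ζ ^ (2 * h + 1)) * numPoly ζ (Finset.Ico (h + 1) v) * g₁ * g₂ * g₃,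
    represents_of_mul_eq hζ.pow_eq_one (by omega) ?_, ?_⟩
  · rw [e1, e2, hg₃]
    linear_combination (-(pairPoly (ζ ^ (2 * h + 1)) * numPoly ζ (Finset.Ico (h + 1) v)) * g₃ *
      geomPoly F d) * hg₁ - (pairPoly (ζ ^ (2 * h + 1)) * numPoly ζ (Finset.Ico (h + 1) v) * g₁ *
      denPoly ζ (Finset.Ico h v) * g₃) * hg₂
  · simp only [eval_mul, eval_pairPoly]
    rw [← hd, hζ.pow_eq_one]
    ring

theorem root_pow_pow_eq_one (hζ : IsPrimitiveRoot ζ d) (m : ℕ) : (ζ ^ m) ^ d = 1 := by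
  rw [← pow_mul, mul_comm, pow_mul, hζ.pow_eq_one, one_pow]

theorem sub_mul_pow_ne_zero (hζ : IsPrimitiveRoot ζ d) {a : F} (had : a ^ d ≠ 1) (m : ℕ) :
    1 - a * ζ ^ m ≠ 0 := by
  refine sub_ne_zero.2 fun e => had ?_
  have := congrArg (· ^ d) e
  simpa [mul_pow, root_pow_pow_eq_one hζ] using this.symm

theorem regular_of_isPrimitiveRoot (hζ : IsPrimitiveRoot ζ d) (hd : d ≠ 0) {a : F} (ha : a ≠ 0)
    (had : a ^ d ≠ 1) : Regular a ζ where
  a_ne := ha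
  q_ne := hζ.ne_zero hd
  up k := by
    rw [mul_assoc, ← pow_add]
    exact sub_mul_pow_ne_zero hζ had _
  down k := by
    refine sub_ne_zero.2 ?_
    rintro rfl
    exact had (root_pow_pow_eq_one hζ _)
  one := by simpa using sub_mul_pow_ne_zero hζ had 1
  three := sub_mul_pow_ne_zero hζ had 3
  five := sub_mul_pow_ne_zero hζ had 5

/-- A polynomial of degree `< d` that is quasi-invariant under `a ↦ a ζ⁶` is a monomial of
degree `(d-1)/2`; if moreover it has a nonzero root, then it is zero. -/
theorem eq_zero_of_quasi_invariant (hζ : IsPrimitiveRoot ζ d) (hd : d = 2 * h + 1)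
    (h6 : d.Coprime 6) {W : F[X]} (hdeg : W.natDegree < d)
    (hW : C (ζ ^ 3) * W.comp (C (ζ ^ 6) * X) = W) {t : F} (ht : t ≠ 0) (hroot : W.eval t = 0) :
    W = 0 := by
  have hcoeff : ∀ j, j ≠ h → W.coeff j = 0 := by
    intro j hj
    by_contra hne
    have hjd : j < d := lt_of_le_of_lt (le_natDegree_of_ne_zero hne) hdeg
    have e := congrArg (fun P => coeff P j) hW
    simp only [coeff_C_mul, comp_C_mul_X_coeff] at e
    -- Comparing coefficients of `a^j` gives `d ∣ 2j+1 < 2d`, which leaves only `2j + 1 = d`.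
    have e1 : ζ ^ (3 * (2 * j + 1)) = 1 := by
      refine mul_left_cancel₀ hne ?_
      rw [mul_one]
      nth_rw 2 [← e]
      ring
    have c3 : d.Coprime 3 := h6.coprime_dvd_right (by norm_num)
    rw [root_pow_mul_eq_one_iff hζ c3] at e1
    obtain ⟨k, hk⟩ := e1
    have hk2 : k < 2 := by
      by_contra hk2
      have : d * 2 ≤ d * k := Nat.mul_le_mul_left d (by omega)
      omega
    interval_cases k <;> omega
  have hmono : W = C (W.coeff h) * X ^ h := by
    ext j
    rw [coeff_C_mul_X_pow]
    split_ifs with hj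
    · rw [hj]
    · exact hcoeff j hj
  rw [hmono, eval_mul, eval_C, eval_pow, eval_X] at hroot
  rw [hmono, (mul_eq_zero.1 hroot).resolve_right (pow_ne_zero h ht), C_0, zero_mul]

/-- Since `(1 + a + ⋯ + a^{d-1})(a-1) = a^d - 1` is invariant under `a ↦ aζ⁶`, multiplying by the
geometric sum absorbs the factors `1-a` and `1-aζ⁶` of the functional equation. What remains is `ζ³
W(ζ⁶a) = W(a)`. -/
theorem sum_pochRatio_eq_zero [Infinite F] (hζ : IsPrimitiveRoot ζ d) (hd : d = 2 * h + 1)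
    (h6 : d.Coprime 6) (s : Finset ℕ) (g : ℕ → F) {t : F} (ht : t ≠ 0)
    (hP : ∀ v ∈ s, g v ≠ 0 → ∃ P, Represents ζ d v P ∧ P.eval t = 0)
    (hfe : ∀ a : F, a ≠ 0 → a ^ d ≠ 1 →
      ζ ^ 3 * (1 - a) * ∑ v ∈ s, pochRatio (a * ζ ^ 6) ζ v * g v =
        (1 - a * ζ ^ 6) * ∑ v ∈ s, pochRatio a ζ v * g v)
    {a : F} (ha : a ≠ 0) (had : a ^ d ≠ 1) : ∑ v ∈ s, pochRatio a ζ v * g v = 0 := by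
  have hP' : ∀ v, ∃ P : F[X], v ∈ s → P.natDegree < d ∧ P.eval t = 0 ∧ ∀ a : F, a ≠ 0 →
      a ^ d ≠ 1 → P.eval a = pochRatio a ζ v * g v * (geomPoly F d).eval a := by
    intro v
    by_cases hv : v ∈ s
    · by_cases hg : g v = 0
      · exact ⟨0, fun _ => ⟨by simp; omega, by simp, by simp [hg]⟩⟩
      · obtain ⟨P, hP, hPt⟩ := hP v hv hg
        refine ⟨C (g v) * P, fun _ => ⟨(natDegree_C_mul_le _ _).trans_lt hP.natDegree_lt,
          by simp [hPt], fun a ha had => ?_⟩⟩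
        rw [eval_mul, eval_C, hP.eval_eq a ha had]
        ring
    · exact ⟨0, fun h => absurd h hv⟩
  choose P hP using hP'
  set W := ∑ v ∈ s, P v with hWdef
  have hWeval : ∀ a : F, a ≠ 0 → a ^ d ≠ 1 →
      W.eval a = (∑ v ∈ s, pochRatio a ζ v * g v) * (geomPoly F d).eval a := by
    intro a ha had
    rw [hWdef, eval_finsetSum, Finset.sum_mul]
    exact Finset.sum_congr rfl fun v hv => (hP v hv).2.2 a ha had
  have hWdeg : W.natDegree < d := by
    refine lt_of_le_of_lt (natDegree_sum_le_of_forall_le s P (n := d - 1) fun v hv => ?_)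
      (by omega)
    have := (hP v hv).1
    omega
  have hWt : W.eval t = 0 := by
    rw [hWdef, eval_finsetSum]
    exact Finset.sum_eq_zero fun v hv => (hP v hv).2.1
  have hζ0 : ζ ≠ 0 := hζ.ne_zero (by omega)
  have hinv : C (ζ ^ 3) * W.comp (C (ζ ^ 6) * X) = W := by
    -- Multiplying by `X(X^d - 1)` disposes of the points where the representation of `W` is not
    -- available.
    have hne : (X * (X ^ d - C 1) : F[X]) ≠ 0 :=
      mul_ne_zero X_ne_zero (X_pow_sub_C_ne_zero (by omega) _)
    refine mul_right_cancel₀ hne (Polynomial.funext fun a => ?_)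
    simp only [eval_mul, eval_C, eval_comp, eval_X, eval_sub, eval_pow]
    by_cases ha : a = 0
    · simp [ha]
    by_cases had : a ^ d = 1
    · simp [had]
    congr 1
    have hbd : (a * ζ ^ 6) ^ d = a ^ d := by rw [mul_pow, root_pow_pow_eq_one hζ, mul_one]
    have h1 := hWeval (a * ζ ^ 6) (mul_ne_zero ha (pow_ne_zero 6 hζ0)) (by rwa [hbd])
    have h2 := hWeval a ha had
    have h3 := eval_geomPoly_mul d (a * ζ ^ 6)
    have h4 := eval_geomPoly_mul d a
    have h5 := hfe a ha had
    rw [hbd] at h3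
    rw [mul_comm (ζ ^ 6), h1, h2]
    have n1 : 1 - a ≠ 0 := by simpa using sub_mul_pow_ne_zero hζ had 0
    have n2 := sub_mul_pow_ne_zero hζ had 6
    refine mul_left_cancel₀ (mul_ne_zero n1 n2) ?_
    generalize ∑ v ∈ s, pochRatio (a * ζ ^ 6) ζ v * g v = S' at *
    generalize ∑ v ∈ s, pochRatio a ζ v * g v = S at *
    generalize eval (a * ζ ^ 6) (geomPoly F d) = E' at *
    generalize eval a (geomPoly F d) = E at *
    linear_combination (1 - a * ζ ^ 6) * E' * h5 - (1 - a * ζ ^ 6) * S * h3 +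
      (1 - a * ζ ^ 6) * S * h4
  have hW0 := eq_zero_of_quasi_invariant hζ hd h6 hWdeg hinv ht hWt
  have := hWeval a ha had
  rw [hW0, eval_zero] at this
  refine (mul_eq_zero.1 this.symm).resolve_right fun e => ?_
  have h4 := eval_geomPoly_mul d a
  rw [e, zero_mul] at h4
  exact had (sub_eq_zero.1 h4.symm)

theorem oddEvenRatio_eq_zero (hζ : IsPrimitiveRoot ζ d) (hd : d = 2 * h + 1) {w : ℕ}
    (hw : h < w) : oddEvenRatio ζ w = 0 := by
  rw [oddEvenRatio, qPoch_eq_zero (i := h) hw, zero_div]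
  rw [← pow_mul, ← pow_succ', ← hd, hζ.pow_eq_one]

theorem one_sub_pow_double_ne_zero (hζ : IsPrimitiveRoot ζ d) (hd : d = 2 * h + 1) {j : ℕ}
    (hj : 0 < j) (hjd : j < d) : 1 - ζ ^ (2 * j) ≠ 0 := by
  rw [sub_ne_zero, ne_comm, Ne, root_pow_mul_eq_one_iff hζ (Nat.coprime_two_right.2 ⟨h, hd⟩)]
  exact Nat.not_dvd_of_pos_of_lt hj hjd

theorem sum_lower_eq_zero [Infinite F] (hζ : IsPrimitiveRoot ζ d) (hd : d = 2 * h + 1)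
    (h6 : d.Coprime 6) (hh : 0 < h) {a : F} (ha : a ≠ 0) (had : a ^ d ≠ 1) :
    ∑ v ∈ Finset.Ico 0 (h + 1), pochRatio a ζ v *
      (oddEvenRatio ζ (2 * v) * (1 - ζ ^ (8 * v + 1)) * ζ ^ (2 * v ^ 2)) = 0 := by
  refine sum_pochRatio_eq_zero hζ hd h6 _ _ (pow_ne_zero 3 (hζ.ne_zero (by omega)))
    (fun v _ hg => ?_) (fun b hb hbd => ?_) ha had
  · refine exists_represents_lower hζ hd h6 ?_
    by_contra hv
    refine hg ?_
    rw [oddEvenRatio_eq_zero hζ hd (by omega)]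
    ring
  · refine wz_sum (regular_of_isPrimitiveRoot hζ (by omega) hb hbd)
      (fun k => oddEvenRatio ζ (2 * k)) (Nat.zero_le _) (fun k _ hk => ?_) (wzCert_zero _ _ _) ?_
    · rcases Nat.lt_or_ge k h with hk' | hk'
      · refine oddEvenRatio_double_succ ?_ ?_
        · rw [show 4 * k + 2 = 2 * (2 * k + 1) by ring]
          exact one_sub_pow_double_ne_zero hζ hd (by omega) (by omega)
        · rw [show 4 * k + 4 = 2 * (2 * k + 2) by ring]
          exact one_sub_pow_double_ne_zero hζ hd (by omega) (by omega)
      -- At the last step both sides are zero: `ζ^{4h+2} = 1`, and `(ζ;ζ²)_{2h}` contains `1 - ζ^d`.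
      · obtain rfl : k = h := by omega
        have : ζ ^ (4 * k + 2) = 1 := by
          rw [hζ.pow_eq_one_iff_dvd]
          exact ⟨2, by omega⟩
        rw [oddEvenRatio_eq_zero hζ hd (by omega : k < 2 * k), this]
        ring
    · have : ζ ^ (4 * (h + 1)) = ζ ^ 2 := by
        rw [show 4 * (h + 1) = 2 + d * 2 by omega, pow_add, pow_mul, hζ.pow_eq_one]
        ring
      rw [wzCert, this]
      ring

theorem sum_upper_eq_zero [Infinite F] (hζ : IsPrimitiveRoot ζ d) (hd : d = 2 * h + 1)
    (h6 : d.Coprime 6) (hh : 1 < h) {a : F} (ha : a ≠ 0) (had : a ^ d ≠ 1) :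
    ∑ v ∈ Finset.Ico (h + 1) d, pochRatio a ζ v *
      (oddEvenRatio ζ (2 * v - d) * (1 - ζ ^ (8 * v + 1)) * ζ ^ (2 * v ^ 2)) = 0 := by
  refine sum_pochRatio_eq_zero hζ hd h6 _ _ one_ne_zero
    (fun v hv _ => ?_) (fun b hb hbd => ?_) ha had
  · rw [Finset.mem_Ico] at hv
    exact exists_represents_upper hζ hd h6 (by omega) hv.2
  · refine wz_sum (regular_of_isPrimitiveRoot hζ (by omega) hb hbd)
      (fun k => oddEvenRatio ζ (2 * k - d)) (by omega) (fun k hk1 hk2 => ?_) ?_ ?_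
    · have hmod : ∀ j, ζ ^ (2 * (2 * k - d) + j) = ζ ^ (4 * k + j) := by
        intro j
        rw [show 4 * k + j = 2 * (2 * k - d) + j + d * 2 by omega, pow_add _ _ (d * 2), pow_mul _ d,
          hζ.pow_eq_one]
        ring
      rcases Nat.lt_or_ge (k + 1) d with hk' | hk'
      · rw [show 2 * (k + 1) - d = 2 * k - d + 2 by omega]
        rw [← hmod, ← hmod, ← hmod, ← hmod]
        refine oddEvenRatio_add_two ?_ ?_
        · rw [show 2 * (2 * k - d) + 2 = 2 * (2 * k - d + 1) by ring]
          exact one_sub_pow_double_ne_zero hζ hd (by omega) (by omega)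
        · rw [show 2 * (2 * k - d) + 4 = 2 * (2 * k - d + 2) by ring]
          exact one_sub_pow_double_ne_zero hζ hd (by omega) (by omega)
      -- Here `k = d - 1`. The ratio vanishes at the index `2k - d = 2h - 1`, which exceeds `h`
      -- because `h > 1`.
      · have : ζ ^ (4 * k + 4) = 1 := by
          rw [hζ.pow_eq_one_iff_dvd]
          exact ⟨4, by omega⟩
        rw [oddEvenRatio_eq_zero hζ hd (by omega : h < 2 * k - d), this]
        ring
    · have : ζ ^ (4 * (h + 1)) = ζ ^ 2 := by
        rw [show 4 * (h + 1) = 2 + d * 2 by omega, pow_add, pow_mul, hζ.pow_eq_one]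
        ring
      rw [wzCert, this]
      ring
    · have : ζ ^ (4 * d) = 1 := by
        rw [hζ.pow_eq_one_iff_dvd]
        exact dvd_mul_left d 4
      rw [wzCert, this]
      ring

end RootOfUnity


/-! ### Cauchy squares of sequences with vanishing half-block sums -/

section Blocks

variable {F : Type*} [Field F]

/-- If the sums of `c` over the lower and the upper half of each block of length `d = 2h + 1`
vanish, and `c` is supported on the lower parts of these halves, then sums of Cauchy coefficients
over whole blocks vanish. -/
theorem sum_cauchy_eq_zero {c : ℕ → F} {d h : ℕ} (hd : d = 2 * h + 1)
    (lower : ∀ u, ∑ v ∈ Finset.Ico 0 (h + 1), c (d * u + v) = 0)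
    (upper : ∀ u, ∑ v ∈ Finset.Ico (h + 1) d, c (d * u + v) = 0)
    (lower_supp : ∀ u v, v ≤ h → h < 2 * v → c (d * u + v) = 0)
    (upper_supp : ∀ u v, h < v → v < d → d + h < 2 * v → c (d * u + v) = 0) (m : ℕ) :
    ∑ k ∈ Finset.range (d * m), ∑ j ∈ Finset.range (k + 1), c j * c (k - j) = 0 := by
  have block : ∀ u, ∑ v ∈ Finset.range d, c (d * u + v) = 0 := by
    intro u
    rw [Finset.range_eq_Ico, ← Finset.sum_Ico_consecutive _ (Nat.zero_le (h + 1)) (by omega),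
      lower, upper, add_zero]
  have blocks : ∀ u, ∑ l ∈ Finset.range (d * u), c l = 0 := by
    intro u
    induction u with
    | zero => simp
    | succ u ih => rw [Nat.mul_succ, Finset.sum_range_add, ih, block, add_zero]
  have partial_lower : ∀ u r, r ≤ h + 1 → h < 2 * r →
      ∑ l ∈ Finset.range (d * u + r), c l = 0 := by
    intro u r hr hr2
    rw [Finset.sum_range_add, blocks, zero_add, ← lower u, ← Finset.range_eq_Ico]
    refine Finset.sum_subset (Finset.range_mono hr) fun v hv hv' => ?_
    rw [Finset.mem_range] at hv hv'
    exact lower_supp u v (by omega) (by omega)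
  have partial_upper : ∀ u r, r ≤ d → d + h < 2 * r →
      ∑ l ∈ Finset.range (d * u + r), c l = 0 := by
    intro u r hr hr2
    rw [Finset.sum_range_add, blocks, zero_add, ← block u]
    refine Finset.sum_subset (Finset.range_mono hr) fun v hv hv' => ?_
    rw [Finset.mem_range] at hv hv'
    exact upper_supp u v (by omega) (by omega) (by omega)
  rw [Finset.sum_range_diag_flip _ fun i j => c i * c j]
  refine Finset.sum_eq_zero fun j hj => ?_
  rw [Finset.mem_range] at hj
  rw [← Finset.mul_sum]
  have hv : j % d < d := Nat.mod_lt _ (by omega)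
  have hu : j / d < m := Nat.div_lt_of_lt_mul hj
  obtain ⟨w, hw⟩ := Nat.exists_eq_add_of_lt hu
  have hj' := Nat.div_add_mod j d
  generalize j % d = v at *
  generalize j / d = u at *
  have e : d * m - j = d * w + (d - v) := by
    have : d * m = d * u + d * w + d := by rw [hw]; ring
    omega
  rw [e]
  -- If `c j ≠ 0`, then `2v ≤ h` or `d < 2v ≤ d + h`. In the first case the inner sum, of length `dw
  -- + (d - v)`, ends beyond the support of an upper half; in the second, beyond that of a lower
  -- half. Either way it vanishes.
  rcases le_or_gt v h with h1 | h1
  · rcases lt_or_ge h (2 * v) with h2 | h2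
    · rw [← hj', lower_supp u v h1 h2, zero_mul]
    · rw [partial_upper w _ (by omega) (by omega), mul_zero]
  · rcases lt_or_ge (d + h) (2 * v) with h2 | h2
    · rw [← hj', upper_supp u v h1 hv h2, zero_mul]
    · rw [partial_lower w _ (by omega) (by omega), mul_zero]

variable {ζ : F} {d h : ℕ}

theorem pochRatio_block_add (hζ : ζ ^ d = 1) (a : F) (u v : ℕ) :
    pochRatio a ζ (d * u + v) = pochRatio a ζ (d * u) * pochRatio a ζ v := by
  have e : ∀ m, (ζ ^ m) ^ (d * u) = 1 := by
    intro m
    rw [← pow_mul, show m * (d * u) = d * (m * u) by ring, pow_mul, hζ, one_pow]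
  simp only [pochRatio, qPoch_add, e, mul_one]
  rw [div_mul_div_comm]
  congr 1 <;> ring

/-- The shape of the values of `cTerm` at a root of unity of order `d`. -/
def rootTerm (a ζ : F) (d : ℕ) (η : ℕ → F) (k : ℕ) : F :=
  pochRatio a ζ k * (η (2 * k / d) * oddEvenRatio ζ (2 * k % d)) * qInt ζ (8 * k + 1) *
    ζ ^ (2 * k ^ 2)

/-- By `ζ^d = 1`, `u` affects only a constant prefactor. The lower half has `s = 2u`, `w = 2v`; the
upper half has `s = 2u+1`, `w = 2v-d`. -/
theorem rootTerm_block_add (hζ : IsPrimitiveRoot ζ d) (hd1 : 1 < d) (a : F) (η : ℕ → F)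
    {u v s w : ℕ} (hw : w < d) (hs : 2 * (d * u + v) = d * s + w) :
    rootTerm a ζ d η (d * u + v) = pochRatio a ζ (d * u) * η s / (1 - ζ) *
      (pochRatio a ζ v * (oddEvenRatio ζ w * (1 - ζ ^ (8 * v + 1)) * ζ ^ (2 * v ^ 2))) := by
  have h1 : 1 - ζ ≠ 0 := sub_ne_zero.2 (hζ.ne_one hd1).symm
  have e1 : 2 * (d * u + v) / d = s := by
    rw [hs, Nat.mul_add_div (by omega), Nat.div_eq_of_lt hw, add_zero]
  have e2 : 2 * (d * u + v) % d = w := by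
    rw [hs, Nat.mul_add_mod, Nat.mod_eq_of_lt hw]
  have e3 : qInt ζ (8 * (d * u + v) + 1) = (1 - ζ ^ (8 * v + 1)) / (1 - ζ) := by
    rw [eq_div_iff h1, mul_comm, one_sub_mul_qInt,
      show 8 * (d * u + v) + 1 = d * (8 * u) + (8 * v + 1) by ring, pow_add, pow_mul,
      hζ.pow_eq_one, one_pow, one_mul]
  have e4 : ζ ^ (2 * (d * u + v) ^ 2) = ζ ^ (2 * v ^ 2) := by
    rw [show 2 * (d * u + v) ^ 2 = d * (2 * d * u ^ 2 + 4 * u * v) + 2 * v ^ 2 by ring, pow_add,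
      pow_mul, hζ.pow_eq_one, one_pow, one_mul]
  rw [rootTerm, e1, e2, e3, e4, pochRatio_block_add hζ.pow_eq_one]
  ring

theorem sum_cauchy_rootTerm [Infinite F] (hζ : IsPrimitiveRoot ζ d) (hd : d = 2 * h + 1)
    (h6 : d.Coprime 6) (hh : 1 < h) {a : F} (ha : a ≠ 0) (had : a ^ d ≠ 1) (η : ℕ → F) (m : ℕ) :
    ∑ k ∈ Finset.range (d * m), ∑ j ∈ Finset.range (k + 1),
      rootTerm a ζ d η j * rootTerm a ζ d η (k - j) = 0 := by
  have lo : ∀ u v, v ≤ h → rootTerm a ζ d η (d * u + v) =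
      pochRatio a ζ (d * u) * η (2 * u) / (1 - ζ) * (pochRatio a ζ v *
        (oddEvenRatio ζ (2 * v) * (1 - ζ ^ (8 * v + 1)) * ζ ^ (2 * v ^ 2))) := fun u v hv =>
    rootTerm_block_add hζ (by omega) a η (by omega) (by ring)
  have up : ∀ u v, h < v → v < d → rootTerm a ζ d η (d * u + v) =
      pochRatio a ζ (d * u) * η (2 * u + 1) / (1 - ζ) * (pochRatio a ζ v *
        (oddEvenRatio ζ (2 * v - d) * (1 - ζ ^ (8 * v + 1)) * ζ ^ (2 * v ^ 2))) :=
    fun u v hv hvd => rootTerm_block_add hζ (by omega) a η (by omega) (by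
      rw [mul_add, mul_add, mul_left_comm, mul_one]
      omega)
  refine sum_cauchy_eq_zero hd (fun u => ?_) (fun u => ?_) (fun u v hv hv2 => ?_)
    (fun u v hv hvd hv2 => ?_) m
  · rw [Finset.sum_congr rfl fun v hv => lo u v (by rw [Finset.mem_Ico] at hv; omega),
      ← Finset.mul_sum, sum_lower_eq_zero hζ hd h6 (by omega) ha had, mul_zero]
  · rw [Finset.sum_congr rfl fun v hv => up u v (by rw [Finset.mem_Ico] at hv; omega)
        (Finset.mem_Ico.1 hv).2,
      ← Finset.mul_sum, sum_upper_eq_zero hζ hd h6 hh ha had, mul_zero]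
  · rw [lo u v hv, oddEvenRatio_eq_zero hζ hd hv2]
    ring
  · rw [up u v hv hvd, oddEvenRatio_eq_zero hζ hd (by omega)]
    ring

end Blocks

/-! ### Specialization of rational functions -/

section Evaluation

variable {R K F : Type*} [CommRing R] [Field K] [Algebra R K] [Field F] {φ : R →+* F}

/-- The element `x` of the fraction field of `R` has a representation as a fraction whose
denominator does not vanish under `φ`, and `y` is its value under `φ`. -/
def EvalsTo (φ : R →+* F) (x : K) (y : F) : Prop :=
  ∃ N D : R, φ D ≠ 0 ∧ x * algebraMap R K D = algebraMap R K N ∧ y * φ D = φ N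

theorem EvalsTo.of_map (φ : R →+* F) (r : R) : EvalsTo φ (algebraMap R K r) (φ r) :=
  ⟨r, 1, by simp, by simp, by simp⟩

theorem EvalsTo.one : EvalsTo φ (1 : K) 1 := by
  simpa using EvalsTo.of_map (K := K) φ 1

theorem EvalsTo.zero : EvalsTo φ (0 : K) 0 := by
  simpa using EvalsTo.of_map (K := K) φ 0

variable {x x' : K} {y y' : F}

theorem EvalsTo.add (h : EvalsTo φ x y) (h' : EvalsTo φ x' y') :
    EvalsTo φ (x + x') (y + y') := by
  obtain ⟨N, D, hD, hx, hy⟩ := h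
  obtain ⟨N', D', hD', hx', hy'⟩ := h'
  refine ⟨N * D' + N' * D, D * D', ?_, ?_, ?_⟩
  · rw [map_mul]
    exact mul_ne_zero hD hD'
  · simp only [map_add, map_mul, ← hx, ← hx']
    ring
  · simp only [map_add, map_mul, ← hy, ← hy']
    ring

theorem EvalsTo.mul (h : EvalsTo φ x y) (h' : EvalsTo φ x' y') :
    EvalsTo φ (x * x') (y * y') := by
  obtain ⟨N, D, hD, hx, hy⟩ := h
  obtain ⟨N', D', hD', hx', hy'⟩ := h'
  refine ⟨N * N', D * D', ?_, ?_, ?_⟩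
  · rw [map_mul]
    exact mul_ne_zero hD hD'
  · simp only [map_mul, ← hx, ← hx']
    ring
  · simp only [map_mul, ← hy, ← hy']
    ring

theorem EvalsTo.neg (h : EvalsTo φ x y) : EvalsTo φ (-x) (-y) := by
  obtain ⟨N, D, hD, hx, hy⟩ := h
  exact ⟨-N, D, hD, by rw [map_neg, ← hx, neg_mul], by rw [map_neg, ← hy, neg_mul]⟩

theorem EvalsTo.sub (h : EvalsTo φ x y) (h' : EvalsTo φ x' y') :
    EvalsTo φ (x - x') (y - y') := by
  rw [sub_eq_add_neg, sub_eq_add_neg]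
  exact h.add h'.neg

theorem EvalsTo.pow (h : EvalsTo φ x y) (n : ℕ) : EvalsTo φ (x ^ n) (y ^ n) := by
  induction n with
  | zero => simpa using EvalsTo.one
  | succ n ih => simpa only [pow_succ] using ih.mul h

theorem EvalsTo.sum {s : Finset ℕ} {f : ℕ → K} {g : ℕ → F}
    (h : ∀ i ∈ s, EvalsTo φ (f i) (g i)) : EvalsTo φ (∑ i ∈ s, f i) (∑ i ∈ s, g i) := by
  induction s using Finset.cons_induction with
  | empty => simpa using EvalsTo.zero
  | cons i s hi ih =>
    rw [Finset.sum_cons, Finset.sum_cons]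
    exact (h i (Finset.mem_cons_self i s)).add
      (ih fun j hj => h j (Finset.mem_cons_of_mem hj))

theorem EvalsTo.prod {s : Finset ℕ} {f : ℕ → K} {g : ℕ → F}
    (h : ∀ i ∈ s, EvalsTo φ (f i) (g i)) : EvalsTo φ (∏ i ∈ s, f i) (∏ i ∈ s, g i) := by
  induction s using Finset.cons_induction with
  | empty => simpa using EvalsTo.one
  | cons i s hi ih =>
    rw [Finset.prod_cons, Finset.prod_cons]
    exact (h i (Finset.mem_cons_self i s)).mul
      (ih fun j hj => h j (Finset.mem_cons_of_mem hj))

variable {q : K} {q' : F}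

theorem EvalsTo.poch (hx : EvalsTo φ x y) (hq : EvalsTo φ q q') (n : ℕ) :
    EvalsTo φ (qPoch x q n) (qPoch y q' n) :=
  EvalsTo.prod fun i _ => EvalsTo.one.sub (hx.mul (hq.pow i))

theorem EvalsTo.int (hq : EvalsTo φ q q') (n : ℕ) : EvalsTo φ (qInt q n) (qInt q' n) :=
  EvalsTo.sum fun i _ => hq.pow i

variable [IsFractionRing R K]

theorem EvalsTo.inv (h : EvalsTo φ x y) (hy0 : y ≠ 0) : EvalsTo φ x⁻¹ y⁻¹ := by
  obtain ⟨N, D, hD, hx, hy⟩ := h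
  have hN : φ N ≠ 0 := hy ▸ mul_ne_zero hy0 hD
  have hN0 : algebraMap R K N ≠ 0 := fun e => hN (by
    rw [(FaithfulSMul.algebraMap_eq_zero_iff R K).1 e, map_zero])
  have hx0 : x ≠ 0 := by
    rintro rfl
    rw [zero_mul] at hx
    exact hN0 hx.symm
  exact ⟨D, N, hN, by rw [← hx, inv_mul_cancel_left₀ hx0],
    by rw [← hy, inv_mul_cancel_left₀ hy0]⟩

theorem EvalsTo.div (h : EvalsTo φ x y) (h' : EvalsTo φ x' y') (hy' : y' ≠ 0) :
    EvalsTo φ (x / x') (y / y') := by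
  rw [div_eq_mul_inv, div_eq_mul_inv]
  exact h.mul (h'.inv hy')

/-- If `x = N/D` with `φ D ≠ 0` and `φ N = 0`, then `num · D = N · den` forces `φ num = 0`. -/
theorem EvalsTo.map_num_eq_zero [IsDomain R] [UniqueFactorizationMonoid R] (h : EvalsTo φ x 0) :
    φ (IsFractionRing.num R x) = 0 := by
  obtain ⟨N, D, hD, hx, hy⟩ := h
  rw [zero_mul] at hy
  have hnum : x * algebraMap R K (IsFractionRing.den R x) =
      algebraMap R K (IsFractionRing.num R x) :=
    IsFractionRing.num_mul_den_eq_num_iff_eq.2 rfl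
  have e : IsFractionRing.num R x * D = N * (IsFractionRing.den R x : R) := by
    apply IsFractionRing.injective R K
    rw [map_mul, map_mul, ← hnum, ← hx]
    ring
  have := congrArg φ e
  rw [map_mul, map_mul, ← hy, zero_mul] at this
  exact (mul_eq_zero.1 this).resolve_right hD

theorem EvalsTo.ratio (hx : EvalsTo φ x y) (hq : EvalsTo φ q q') (hy : y ≠ 0) {k : ℕ}
    (h1 : qPoch (y * q' ^ 6) (q' ^ 6) k ≠ 0) (h2 : qPoch (q' ^ 6 / y) (q' ^ 6) k ≠ 0) :
    EvalsTo φ (pochRatio x q k) (pochRatio y q' k) :=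
  (((hx.mul hq).poch (hq.pow 2) k).mul ((hq.div hx hy).poch (hq.pow 2) k)).div
    (((hx.mul (hq.pow 6)).poch (hq.pow 6) k).mul (((hq.pow 6).div hx hy).poch (hq.pow 6) k))
    (mul_ne_zero h1 h2)

theorem EvalsTo.oddEven (hq : EvalsTo φ q q') {m : ℕ}
    (h : qPoch (q' ^ 2) (q' ^ 2) m ≠ 0) :
    EvalsTo φ (oddEvenRatio q m) (oddEvenRatio q' m) :=
  (hq.poch (hq.pow 2) m).div ((hq.pow 2).poch (hq.pow 2) m) h

theorem EvalsTo.term (hx : EvalsTo φ x y) (hq : EvalsTo φ q q') (hy : y ≠ 0) {k : ℕ}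
    (h1 : qPoch (y * q' ^ 6) (q' ^ 6) k ≠ 0) (h2 : qPoch (q' ^ 6 / y) (q' ^ 6) k ≠ 0)
    (h3 : qPoch (q' ^ 2) (q' ^ 2) (2 * k) ≠ 0) :
    EvalsTo φ (cTerm x q k) (cTerm y q' k) := by
  rw [cTerm_eq, cTerm_eq]
  exact (((hx.ratio hq hy h1 h2).mul (hq.oddEven h3)).mul (hq.int _)).mul (hq.pow _)

theorem oddEvenRatio_add (q : K) (m n : ℕ) :
    oddEvenRatio q (m + n) = oddEvenRatio q m *
      (qPoch (q * (q ^ 2) ^ m) (q ^ 2) n /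
        qPoch (q ^ 2 * (q ^ 2) ^ m) (q ^ 2) n) := by
  rw [oddEvenRatio, qPoch_add, qPoch_add, mul_div_mul_comm, oddEvenRatio]

variable {d h : ℕ}

/-- `(q;q²)_m / (q²;q²)_m` is regular at roots of unity of odd order `d`, for `d ∣ m`. -/
theorem exists_evalsTo_oddEvenRatio [CharZero F] (hq : EvalsTo φ q q')
    (hζ : IsPrimitiveRoot q' d) (hd : d = 2 * h + 1) (hqd : q ^ d ≠ 1) (s : ℕ) :
    ∃ η, EvalsTo φ (oddEvenRatio q (d * s)) η := by
  induction s with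
  | zero => exact ⟨1, by simpa [oddEvenRatio, qPoch_zero] using EvalsTo.one⟩
  | succ s ih =>
    obtain ⟨η, hη⟩ := ih
    rw [Nat.mul_succ, oddEvenRatio_add]
    have hQ : EvalsTo φ (q ^ d) 1 := by simpa [hζ.pow_eq_one] using hq.pow d
    have hI : ∀ n : ℕ, qInt (1 : F) n = n := by simp [qInt]
    -- Each new block brings one vanishing factor above and one below. Cancelling `1 - q^d` leaves
    -- `[2s+1]/[2s+2]` in base `q^d → 1`.
    have hlast : EvalsTo φ ((1 - (q ^ d) ^ (2 * s + 1)) / (1 - (q ^ d) ^ (2 * s + 2)))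
        (((2 * s + 1 : ℕ) : F) / ((2 * s + 2 : ℕ) : F)) := by
      rw [← one_sub_mul_qInt (q ^ d), ← one_sub_mul_qInt (q ^ d), mul_div_mul_left _ _ (sub_ne_zero.2 hqd.symm),
        ← hI, ← hI]
      refine (hQ.int _).div (hQ.int _) ?_
      rw [hI]
      exact Nat.cast_ne_zero.2 (by omega)
    have enum : qPoch (q * (q ^ 2) ^ (d * s)) (q ^ 2) d =
        (1 - (q ^ d) ^ (2 * s + 1)) * ∏ i ∈ (Finset.range d).erase h,
          (1 - q * (q ^ 2) ^ (d * s) * (q ^ 2) ^ i) := by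
      rw [qPoch, ← Finset.mul_prod_erase _ _ (Finset.mem_range.2 (by omega : h < d))]
      congr 2
      rw [hd]
      ring
    have eden : qPoch (q ^ 2 * (q ^ 2) ^ (d * s)) (q ^ 2) d =
        (1 - (q ^ d) ^ (2 * s + 2)) * qPoch (q ^ 2 * (q ^ 2) ^ (d * s)) (q ^ 2) (2 * h) := by
      rw [mul_comm (1 - _), show qPoch (q ^ 2 * (q ^ 2) ^ (d * s)) (q ^ 2) d =
        qPoch (q ^ 2 * (q ^ 2) ^ (d * s)) (q ^ 2) (2 * h + 1) by rw [← hd], qPoch_succ]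
      congr 2
      rw [hd]
      ring
    rw [enum, eden, mul_div_mul_comm]
    refine ⟨_, hη.mul (hlast.mul ((EvalsTo.prod fun i _ => EvalsTo.one.sub
      ((hq.mul ((hq.pow 2).pow _)).mul ((hq.pow 2).pow i))).div
        (((hq.pow 2).mul ((hq.pow 2).pow _)).poch (hq.pow 2) _) (qPoch_ne_zero fun i hi => ?_)))⟩
    rw [← pow_mul, ← pow_mul, ← pow_add, ← pow_add,
      show 2 + 2 * (d * s) + 2 * i = 2 * (i + 1) + d * (2 * s) by ring, pow_add, pow_mul _ d,
      hζ.pow_eq_one, one_pow, mul_one]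
    exact fun e => one_sub_pow_double_ne_zero hζ hd (by omega : 0 < i + 1) (by omega)
      (by rw [e, sub_self])

theorem exists_evalsTo_rootTerm [CharZero F] (hx : EvalsTo φ x y) (hq : EvalsTo φ q q')
    (hy : y ≠ 0) (hζ : IsPrimitiveRoot q' d) (hd : d = 2 * h + 1) (hqd : q ^ d ≠ 1)
    (hyd : y ^ d ≠ 1) :
    ∃ η : ℕ → F, ∀ k, EvalsTo φ (cTerm x q k) (rootTerm y q' d η k) := by
  choose η hη using exists_evalsTo_oddEvenRatio hq hζ hd hqd
  refine ⟨η, fun k => ?_⟩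
  have hA : EvalsTo φ (pochRatio x q k) (pochRatio y q' k) := by
    refine hx.ratio hq hy (qPoch_ne_zero fun i _ => ?_) (qPoch_ne_zero fun i _ => ?_)
    · rw [mul_assoc, ← pow_succ', ← pow_mul]
      exact fun e => sub_mul_pow_ne_zero hζ hyd _ (sub_eq_zero.2 e.symm)
    · rw [div_mul_eq_mul_div, ← pow_succ', ← pow_mul, Ne, div_eq_one_iff_eq hy]
      exact fun e => hyd (by rw [← e, root_pow_pow_eq_one hζ])
  have hB : EvalsTo φ (oddEvenRatio q (2 * k))
      (η (2 * k / d) * oddEvenRatio q' (2 * k % d)) := by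
    conv_lhs => rw [← Nat.div_add_mod (2 * k) d]
    have hw : 2 * k % d < d := Nat.mod_lt _ (by omega)
    generalize 2 * k % d = w at *
    generalize 2 * k / d = s at *
    rw [oddEvenRatio_add]
    refine (hη s).mul ?_
    have e : (q' ^ 2) ^ (d * s) = 1 := by
      rw [← pow_mul, show 2 * (d * s) = d * (2 * s) by ring, pow_mul, hζ.pow_eq_one, one_pow]
    have h1 := (hq.mul ((hq.pow 2).pow (d * s))).poch (hq.pow 2) w
    have h2 := ((hq.pow 2).mul ((hq.pow 2).pow (d * s))).poch (hq.pow 2) w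
    rw [e, mul_one] at h1 h2
    refine h1.div h2 (qPoch_ne_zero fun i hi => ?_)
    rw [← pow_succ', ← pow_mul]
    exact fun e => one_sub_pow_double_ne_zero hζ hd (by omega : 0 < i + 1) (by omega)
      (by rw [e, sub_self])
  rw [cTerm_eq]
  exact ((hA.mul hB).mul (hq.int _)).mul (hq.pow _)

end Evaluation


/-! ### From vanishing at a point to divisibility -/

section Kernels

open Polynomial

variable {F : Type*} [Field F]

/-- Evaluation of polynomials in `ℤ[a, q]` at a point. -/
def evalAQ (α β : F) : PolyAQ →+* F :=
  eval₂RingHom (eval₂RingHom (Int.castRingHom F) α) β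

theorem evalAQ_polyA (α β : F) : evalAQ α β polyA = α := by simp [evalAQ, polyA]

theorem evalAQ_polyQ (α β : F) : evalAQ α β polyQ = β := by simp [evalAQ, polyQ]

theorem evalAQ_eq_swap (α β : F) (f : PolyAQ) :
    evalAQ α β f = eval₂ (eval₂RingHom (Int.castRingHom F) β) α (Bivariate.swap f) := by
  have : evalAQ α β = (eval₂RingHom (eval₂RingHom (Int.castRingHom F) β) α).comp
      (Bivariate.swap (R := ℤ)).toRingEquiv.toRingHom := by
    refine ringHom_ext' (ringHom_ext' (RingHom.ext_int _ _) ?_) ?_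
    · change evalAQ α β (C X) = eval₂RingHom _ α (Bivariate.swap (C X))
      rw [Bivariate.swap_X]
      simp [evalAQ]
    · change evalAQ α β X = eval₂RingHom _ α (Bivariate.swap X)
      rw [Bivariate.swap_Y]
      simp [evalAQ]
  rw [this]
  rfl

theorem dvd_of_swap_dvd {P f : PolyAQ} (h : Bivariate.swap P ∣ Bivariate.swap f) : P ∣ f := by
  simpa only [Bivariate.swap_swap_apply] using _root_.map_dvd (Bivariate.swap (R := ℤ)) h

theorem swap_polyA : Bivariate.swap polyA = (X : PolyAQ) := Bivariate.swap_X

theorem swap_polyQ : Bivariate.swap polyQ = (C X : PolyAQ) := Bivariate.swap_Y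

/-- The field `ℚ(q)`. -/
abbrev FracQ : Type := FractionRing ℤ[X]

/-- The generator of `ℚ(q)`. -/
def genQ : FracQ := algebraMap ℤ[X] FracQ X

theorem eval₂RingHom_genQ :
    eval₂RingHom (Int.castRingHom FracQ) genQ = algebraMap ℤ[X] FracQ := by
  refine ringHom_ext' (RingHom.ext_int _ _) ?_
  simp [genQ]

theorem algebraMap_X_pow_ne_one {R K : Type*} [CommRing R] [IsDomain R] [Field K]
    [Algebra R[X] K] [IsFractionRing R[X] K] {m : ℕ} (hm : 0 < m) :
    (algebraMap R[X] K X) ^ m ≠ 1 := by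
  intro h
  rw [← map_pow, ← map_one (algebraMap R[X] K)] at h
  have := congrArg natDegree (IsFractionRing.injective R[X] K h)
  rw [natDegree_X_pow, natDegree_one] at this
  omega

theorem algebraMap_X_ne_zero (R K : Type*) [CommRing R] [IsDomain R] [Field K]
    [Algebra R[X] K] [IsFractionRing R[X] K] : algebraMap R[X] K X ≠ 0 :=
  fun h => X_ne_zero ((FaithfulSMul.algebraMap_eq_zero_iff R[X] K).1 h)

theorem genQ_pow_ne_one (m : ℕ) (hm : 0 < m) : genQ ^ m ≠ 1 := algebraMap_X_pow_ne_one hm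

theorem genQ_ne_zero : genQ ≠ 0 := algebraMap_X_ne_zero ℤ FracQ

/-- Gauss's lemma over `ℤ[q]`: for primitive `P`, divisibility over `ℚ(q)[a]` descends. The swap
makes `a` the main variable. -/
theorem dvd_of_evalAQ_genQ_eq_zero {P f : PolyAQ} {α : FracQ}
    (hprim : (Bivariate.swap P).IsPrimitive)
    (hP : (Bivariate.swap P).map (algebraMap ℤ[X] FracQ) ∣ X - C α)
    (hf : evalAQ α genQ f = 0) : P ∣ f := by
  refine dvd_of_swap_dvd (hprim.dvd_of_fraction_map_dvd_fraction_map (K := FracQ) ?_)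
  refine hP.trans (dvd_iff_isRoot.2 ?_)
  rw [evalAQ_eq_swap, eval₂RingHom_genQ] at hf
  rwa [IsRoot, eval_map]

theorem polyA_sub_dvd {n : ℕ} {f : PolyAQ} (hf : evalAQ (genQ ^ n) genQ f = 0) :
    polyA - polyQ ^ n ∣ f := by
  have e : Bivariate.swap (polyA - polyQ ^ n) = X - C (X ^ n) := by
    rw [map_sub, map_pow, swap_polyA, swap_polyQ, C_pow]
  refine dvd_of_evalAQ_genQ_eq_zero ?_ ?_ hf <;> rw [e]
  · exact (monic_X_sub_C _).isPrimitive
  · rw [Polynomial.map_sub, map_X, map_C, map_pow, genQ]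

theorem one_sub_polyA_mul_dvd {n : ℕ} {f : PolyAQ} (hf : evalAQ (genQ ^ n)⁻¹ genQ f = 0) :
    1 - polyA * polyQ ^ n ∣ f := by
  have e : Bivariate.swap (1 - polyA * polyQ ^ n) = 1 - X * C (X ^ n) := by
    rw [map_sub, map_mul, map_pow, swap_polyA, swap_polyQ, C_pow, map_one]
  refine dvd_of_evalAQ_genQ_eq_zero ?_ ?_ hf <;> rw [e]
  · intro r hr
    have := (C_dvd_iff_dvd_coeff _ _).1 hr 0
    simp only [coeff_sub, coeff_one_zero, coeff_mul_C, coeff_X_zero, zero_mul, sub_zero] at this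
    exact isUnit_of_dvd_one this
  · have h0 : genQ ^ n ≠ 0 := pow_ne_zero n genQ_ne_zero
    have h1 : (C (genQ ^ n)⁻¹ : FracQ[X]) * C (genQ ^ n) = 1 := by
      rw [← C_mul, inv_mul_cancel₀ h0, C_1]
    refine ⟨-C (genQ ^ n)⁻¹, ?_⟩
    rw [Polynomial.map_sub, Polynomial.map_mul, Polynomial.map_one, map_X, map_C, map_pow]
    change _ = (1 - X * C (genQ ^ n)) * _
    linear_combination (-X) * h1

/-- The field `ℂ(a)`. -/
abbrev FracA : Type := FractionRing ℂ[X]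

/-- The generator of `ℂ(a)`. -/
def genA : FracA := algebraMap ℂ[X] FracA X

theorem evalAQ_genA (ζ : ℂ) (f : PolyAQ) :
    evalAQ genA (algebraMap ℂ[X] FracA (C ζ)) f =
      algebraMap ℂ[X] FracA ((Bivariate.swap f).map (eval₂RingHom (Int.castRingHom ℂ) ζ)) := by
  rw [evalAQ_eq_swap]
  have : eval₂RingHom (eval₂RingHom (Int.castRingHom FracA) (algebraMap ℂ[X] FracA (C ζ))) genA =
      (algebraMap ℂ[X] FracA).comp (mapRingHom (eval₂RingHom (Int.castRingHom ℂ) ζ)) := by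
    refine ringHom_ext' (ringHom_ext' (RingHom.ext_int _ _) ?_) ?_
    · simp
    · simp [genA]
  exact congrArg (fun φ => φ (Bivariate.swap f)) this

/-- As `a` stays transcendental, every coefficient of a power of `a` vanishes at `q = ζ`, and the
minimal polynomial of `ζ` over `ℤ` divides each of them. -/
theorem cyclotomic_dvd_of_evalAQ {d : ℕ} (hd : 0 < d) {ζ : ℂ} (hζ : IsPrimitiveRoot ζ d)
    {f : PolyAQ} (hf : evalAQ genA (algebraMap ℂ[X] FracA (C ζ)) f = 0) :
    cyclotomic d ℤ[X] ∣ f := by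
  rw [evalAQ_genA, FaithfulSMul.algebraMap_eq_zero_iff] at hf
  have e : Bivariate.swap (cyclotomic d ℤ[X]) = C (cyclotomic d ℤ) := by
    rw [← map_cyclotomic d (C : ℤ →+* ℤ[X]), Bivariate.swap_map_C]
  refine dvd_of_swap_dvd ?_
  rw [e, C_dvd_iff_dvd_coeff]
  intro i
  rw [cyclotomic_eq_minpoly hζ hd]
  refine minpoly.isIntegrallyClosed_dvd (hζ.isIntegral hd) ?_
  have := congrArg (fun p => coeff p i) hf
  rw [coeff_map, coeff_zero] at this
  exact this

end Kernels

/-! ### Divisibility of the reduced numerator -/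

section Assembly

open Polynomial

theorem ratQ_pow_ne_one {m : ℕ} (hm : 0 < m) : ratQ ^ m ≠ 1 := algebraMap_X_pow_ne_one hm

theorem ratQ_ne_zero : ratQ ≠ 0 := algebraMap_X_ne_zero ℤ[X] RatAQ

/-- This accumulates the factors of the modulus one at a time: nonvanishing of the earlier factors
at the new point replaces a coprimality argument. -/
theorem mul_dvd_of_eval_eq_zero {R F : Type*} [CommRing R] [Field F] {φ : R →+* F} {P f g : R}
    (hker : ∀ t, φ t = 0 → P ∣ t) (hg : g ∣ f) (hf : φ f = 0) (hφg : φ g ≠ 0) : g * P ∣ f := by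
  obtain ⟨t, rfl⟩ := hg
  rw [map_mul] at hf
  exact mul_dvd_mul_left g (hker t ((mul_eq_zero.1 hf).resolve_left hφg))

theorem ratCongr_of_dvd_num {P : PolyAQ} {A B : RatAQ}
    (h : P ∣ IsFractionRing.num PolyAQ (A - B)) : RatCongr P A B :=
  ⟨IsFractionRing.num PolyAQ (A - B), IsFractionRing.den PolyAQ (A - B),
    nonZeroDivisors.coe_ne_zero _, (IsFractionRing.mk'_num_den' PolyAQ (A - B)).symm, h,
    (IsFractionRing.num_den_reduced PolyAQ (A - B)).of_dvd_left h⟩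

variable {F : Type*} [Field F]

theorem evalsTo_ratA (α β : F) : EvalsTo (evalAQ α β) ratA α := by
  have h := EvalsTo.of_map (K := RatAQ) (evalAQ α β) polyA
  rwa [evalAQ_polyA] at h

theorem evalsTo_ratQ (α β : F) : EvalsTo (evalAQ α β) ratQ β := by
  have h := EvalsTo.of_map (K := RatAQ) (evalAQ α β) polyQ
  rwa [evalAQ_polyQ] at h

theorem evalAQ_qInt (α β : F) (n : ℕ) : evalAQ α β (qInt polyQ n) = qInt β n := by
  simp [qInt, evalAQ_polyQ]

/-- The difference of the two sides of the congruence. -/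
def congrDiff (n : ℕ) : RatAQ :=
  (∑ k ∈ Finset.range n, aCoeff ratA ratQ k) - ratQ ^ (-((n : ℤ) - 1)) * qInt ratQ n ^ 2

theorem evalsTo_congrDiff {α β : F} (hβ : β ≠ 0) {c : ℕ → F} {n : ℕ}
    (hc : ∀ k < n, EvalsTo (evalAQ α β) (cTerm ratA ratQ k) (c k)) :
    EvalsTo (evalAQ α β) (congrDiff n)
      ((∑ k ∈ Finset.range n, ∑ j ∈ Finset.range (k + 1), c j * c (k - j)) -
        β ^ (-((n : ℤ) - 1)) * qInt β n ^ 2) := by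
  have hQ := evalsTo_ratQ α β
  refine EvalsTo.sub (EvalsTo.sum fun k hk => EvalsTo.sum fun j hj => ?_) (EvalsTo.mul ?_
    ((hQ.int n).pow 2))
  · rw [Finset.mem_range] at hk hj
    exact (hc j (by omega)).mul (hc (k - j) (by omega))
  · rw [neg_sub, zpow_sub₀ hβ, zpow_sub₀ ratQ_ne_zero, zpow_one, zpow_natCast, zpow_one,
      zpow_natCast]
    exact hQ.div (hQ.pow n) (pow_ne_zero n hβ)

theorem qPoch_up_ne_zero {a q : F} (h : Regular a q) (k : ℕ) :
    qPoch (a * q ^ 6) (q ^ 6) k ≠ 0 :=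
  qPoch_ne_zero fun i _ => by
    rw [← pow_mul]
    exact (sub_ne_zero.1 (h.up i)).symm

theorem qPoch_down_ne_zero {a q : F} (h : Regular a q) (k : ℕ) :
    qPoch (q ^ 6 / a) (q ^ 6) k ≠ 0 :=
  qPoch_ne_zero fun i _ => by
    rw [← pow_mul, div_mul_eq_mul_div, Ne, div_eq_one_iff_eq h.a_ne]
    exact (sub_ne_zero.1 (h.down' i)).symm

theorem qPoch_genQ_ne_zero (k : ℕ) : qPoch (genQ ^ 2) (genQ ^ 2) k ≠ 0 :=
  qPoch_ne_zero fun i _ => by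
    rw [← pow_mul, ← pow_add]
    exact genQ_pow_ne_one _ (by omega)

theorem regular_genQ {n : ℕ} (hn : n.Coprime 6) : Regular (genQ ^ n) genQ :=
  regular_pow genQ_ne_zero genQ_pow_ne_one hn

theorem evalAQ_num_eq_zero_of_pow {n : ℕ} (hn : n.Coprime 6) :
    evalAQ (genQ ^ n) genQ (IsFractionRing.num PolyAQ (congrDiff n)) = 0 := by
  have hr := regular_genQ hn
  have := evalsTo_congrDiff (α := genQ ^ n) genQ_ne_zero (n := n) fun k _ =>
    (evalsTo_ratA _ _).term (evalsTo_ratQ _ _) hr.a_ne (qPoch_up_ne_zero hr k)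
      (qPoch_down_ne_zero hr k) (qPoch_genQ_ne_zero _)
  refine EvalsTo.map_num_eq_zero ?_
  convert this
  exact (sub_eq_zero.2 (sum_aCoeff_pow genQ_ne_zero genQ_pow_ne_one hn)).symm

theorem evalAQ_num_eq_zero_of_inv_pow {n : ℕ} (hn : n.Coprime 6) :
    evalAQ (genQ ^ n)⁻¹ genQ (IsFractionRing.num PolyAQ (congrDiff n)) = 0 := by
  have hr := regular_genQ hn
  have := evalsTo_congrDiff (α := (genQ ^ n)⁻¹) genQ_ne_zero (n := n) fun k _ =>
    (evalsTo_ratA _ _).term (evalsTo_ratQ _ _) (inv_ne_zero hr.a_ne)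
      (by rw [mul_comm, ← div_eq_mul_inv]; exact qPoch_down_ne_zero hr k)
      (by rw [div_inv_eq_mul, mul_comm]; exact qPoch_up_ne_zero hr k) (qPoch_genQ_ne_zero _)
  refine EvalsTo.map_num_eq_zero ?_
  convert this
  simp only [cTerm_inv]
  exact (sub_eq_zero.2 (sum_aCoeff_pow genQ_ne_zero genQ_pow_ne_one hn)).symm

theorem qInt_eq_zero {ζ : F} {d n : ℕ} (hζ : IsPrimitiveRoot ζ d) (hd : 1 < d) (hdn : d ∣ n) :
    qInt ζ n = 0 := by
  have h := one_sub_mul_qInt ζ n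
  rw [(hζ.pow_eq_one_iff_dvd n).2 hdn, sub_self] at h
  exact (mul_eq_zero.1 h).resolve_left (sub_ne_zero.2 (hζ.ne_one hd).symm)

theorem genA_ne_zero : genA ≠ 0 := algebraMap_X_ne_zero ℂ FracA

theorem genA_pow_ne_one {m : ℕ} (hm : 0 < m) : genA ^ m ≠ 1 := algebraMap_X_pow_ne_one hm

theorem evalAQ_num_eq_zero_of_root {n d : ℕ} (hn : n.Coprime 6) (hdn : d ∣ n) (hd : 1 < d)
    {ζ : FracA} (hζ : IsPrimitiveRoot ζ d) :
    evalAQ genA ζ (IsFractionRing.num PolyAQ (congrDiff n)) = 0 := by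
  have h6 : d.Coprime 6 := hn.coprime_dvd_left hdn
  obtain ⟨h, hh⟩ := odd_of_coprime_six h6
  have h1 : 1 < h := by
    -- An odd `d > 1` with `h ≤ 1` would be 3, which is not coprime to 6.
    by_contra hlt
    have : d = 3 := by omega
    exact not_three_dvd_of_coprime_six h6 (dvd_of_eq this.symm)
  have : Infinite FracA := Infinite.of_injective _ (Nat.cast_injective (R := FracA))
  have had := genA_pow_ne_one (m := d) (by omega)
  obtain ⟨η, hη⟩ := exists_evalsTo_rootTerm (evalsTo_ratA genA ζ) (evalsTo_ratQ genA ζ)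
    genA_ne_zero hζ hh (ratQ_pow_ne_one (by omega)) had
  have := evalsTo_congrDiff (hζ.ne_zero (by omega)) (n := n) fun k _ => hη k
  refine EvalsTo.map_num_eq_zero ?_
  convert this
  obtain ⟨m, hm⟩ := hdn
  rw [qInt_eq_zero hζ hd ⟨m, hm⟩, hm, sum_cauchy_rootTerm hζ hh h6 h1 genA_ne_zero had]
  ring

theorem exists_isPrimitiveRoot_C {d : ℕ} (hd : 0 < d) :
    ∃ ζ : ℂ, IsPrimitiveRoot ζ d ∧ IsPrimitiveRoot (algebraMap ℂ[X] FracA (C ζ)) d := by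
  have h := Complex.isPrimitiveRoot_exp d (by omega)
  exact ⟨_, h, (h.map_of_injective (f := (C : ℂ →+* ℂ[X])) C_injective).map_of_injective
    (f := algebraMap ℂ[X] FracA) (IsFractionRing.injective ℂ[X] FracA)⟩

theorem evalAQ_cyclotomic (α β : F) (e : ℕ) :
    evalAQ α β (cyclotomic e ℤ[X]) = (cyclotomic e F).eval β := by
  rw [evalAQ, coe_eval₂RingHom, ← eval_map, map_cyclotomic]

theorem cyclotomic_eval_ne_zero [CharZero F] {ζ : F} {d e : ℕ} (hζ : IsPrimitiveRoot ζ d)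
    (he : 0 < e) (hde : d ≠ e) : (cyclotomic e F).eval ζ ≠ 0 := by
  have : NeZero (e : F) := ⟨Nat.cast_ne_zero.2 he.ne'⟩
  intro h
  exact hde (hζ.unique (isRoot_cyclotomic_iff.1 h))

/-- `[n]` is the product of the cyclotomic polynomials `Φ_d(q)` over `d ∣ n`, `d > 1`, and `Φ_e`
does not vanish at a primitive `d`-th root of unity when `e ≠ d`. -/
theorem qInt_dvd_num {n : ℕ} (hn : n.Coprime 6) :
    qInt polyQ n ∣ IsFractionRing.num PolyAQ (congrDiff n) := by
  have hn0 : 0 < n := Nat.pos_of_ne_zero (by rintro rfl; revert hn; decide)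
  have e : qInt polyQ n = ∏ d ∈ n.divisors.erase 1, cyclotomic d ℤ[X] :=
    (prod_cyclotomic_eq_geom_sum hn0 ℤ[X]).symm
  rw [e]
  suffices ∀ s ⊆ n.divisors.erase 1, ∏ d ∈ s, cyclotomic d ℤ[X] ∣
      IsFractionRing.num PolyAQ (congrDiff n) from this _ subset_rfl
  intro s
  induction s using Finset.cons_induction with
  | empty => simp
  | cons d s hds ih =>
    intro hs
    have hpos : ∀ e ∈ Finset.cons d s hds, 0 < e := fun e he =>
      Nat.pos_of_mem_divisors (Finset.mem_of_mem_erase (hs he))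
    have hd := hs (Finset.mem_cons_self d s)
    have hd0 := hpos d (Finset.mem_cons_self d s)
    have hd1 := Finset.ne_of_mem_erase hd
    obtain ⟨ζ, hζ, hζ'⟩ := exists_isPrimitiveRoot_C hd0
    rw [Finset.prod_cons, mul_comm]
    refine mul_dvd_of_eval_eq_zero (fun t => cyclotomic_dvd_of_evalAQ hd0 hζ)
      (ih fun e he => hs (Finset.mem_cons_of_mem he))
      (evalAQ_num_eq_zero_of_root hn (Nat.dvd_of_mem_divisors (Finset.mem_of_mem_erase hd))
        (by omega) hζ') ?_
    rw [map_prod]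
    refine Finset.prod_ne_zero_iff.2 fun e he => ?_
    rw [evalAQ_cyclotomic]
    exact cyclotomic_eval_ne_zero hζ' (hpos e (Finset.mem_cons_of_mem he))
      (fun h => hds (h ▸ he))

theorem qInt_genQ_ne_zero {n : ℕ} (hn : 0 < n) : qInt genQ n ≠ 0 := by
  intro h
  have := one_sub_mul_qInt genQ n
  rw [h, mul_zero] at this
  exact genQ_pow_ne_one n hn (sub_eq_zero.1 this.symm).symm

end Assembly

end

theorem theorem3 (n : ℕ) (hn : n.Coprime 6) :
    RatCongr (qInt polyQ n * (1 - polyA * polyQ ^ n) * (polyA - polyQ ^ n))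
      (∑ k ∈ Finset.range n, aCoeff ratA ratQ k)
      (ratQ ^ (-((n : ℤ) - 1)) * qInt ratQ n ^ 2) := by
  have hn0 : 0 < n := Nat.pos_of_ne_zero (by rintro rfl; revert hn; decide)
  refine ratCongr_of_dvd_num ?_
  refine mul_dvd_of_eval_eq_zero (fun t => polyA_sub_dvd) ?_ (evalAQ_num_eq_zero_of_pow hn) ?_
  · refine mul_dvd_of_eval_eq_zero (fun t => one_sub_polyA_mul_dvd) (qInt_dvd_num hn)
      (evalAQ_num_eq_zero_of_inv_pow hn) ?_
    rw [evalAQ_qInt]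
    exact qInt_genQ_ne_zero hn0
  -- At `a = qⁿ` the earlier factors become `[n](1 - q^{2n})`, which is nonzero.
  · rw [map_mul, evalAQ_qInt, map_sub, map_one, map_mul, map_pow, evalAQ_polyA, evalAQ_polyQ,
      ← pow_add]
    exact mul_ne_zero (qInt_genQ_ne_zero hn0)
      (sub_ne_zero.2 (genQ_pow_ne_one _ (by omega)).symm)
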